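/- Let $W$ be a Coxeter group with finite set $S$ of simple generators and labels $m(s,s')\in\{1,2,3,\dots\}\cup\{\infty\}$. Let $A=(a_{ss'})_{s,s'\in S}$ be a real symmetrizable generalized Cartan matrix for $W$: $a_{ss}=2$; for $s\ne s'$, $a_{ss'}\le 0$, with $a_{ss'}a_{s's}=4\cos^2(\pi/m(s,s'))$ if $m(s,s')<\infty$ and $a_{ss'}a_{s's}\ge 4$ if $m(s,s')=\infty$; $a_{ss'}=0$ if and only if $a_{s's}=0$; and there is $\delta:S\to\mathbb{R}_{>0}$, which we fix, with $\delta(s)a_{ss'}=\delta(s')a_{s's}$ for all $s,s'$ and $\delta(s)=\delta(s')$ whenever $s$ and $s'$ are conjugate in $W$. Let $V$ be the real vector space with basis $(\alpha_s)_{s\in S}$, on which $W$ acts by $s(\alpha_{s'})=\alpha_{s'}-a_{ss'}\alpha_s$, and put $\alpha_s^\vee=\delta(s)^{-1}\alpha_s$. For a reflection $t=usu^{-1}$ ($u\in W$, $s\in S$), let $\beta_t$ be the positive root of $t$, i.e. the one of $\pm u\alpha_s$ whose coordinates in the basis $(\alpha_r)_{r\in S}$ are all nonnegative (it depends only on $t$).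 Let $c=s_1\cdots s_n$ be a Coxeter element, where $s_1,\dots,s_n$ are the distinct elements of $S$. Define a bilinear form $E_c$ on $V$ by $E_c(\alpha_{s_i}^\vee,\alpha_{s_j})=a_{s_is_j}$ if $i>j$, $1$ if $i=j$, and $0$ if $i<j$, and let $\omega_c(\beta,\beta')=E_c(\beta,\beta')-E_c(\beta',\beta)$. For a reduced word $r_1\cdots r_n$ for $c$, the $(r_1\cdots r_n)$-sorting word for $w\in W$ is the subword of the half-infinite word $(r_1\cdots r_n)^\infty=r_1\cdots r_n|r_1\cdots r_n|\cdots$ that is lexicographically first, as a sequence of positions, among the subwords that are reduced words for $w$. A $c$-sorting word for $w$ is an $(r_1\cdots r_n)$-sorting word for $w$ for some reduced word $r_1\cdots r_n$ for $c$. The element $w$ is $c$-sortable if, for a $c$-sorting word for $w$, the sets of letters that it takes from the successive copies of $r_1\cdots r_n$ form a sequence that is weakly decreasing under inclusion. Let $a_1\cdots a_k$ be a reduced word for some $w\in W$, with reflection sequence $t_1,\dots,t_k$, $t_i=a_1a_2\cdots a_i\cdots a_2a_1$. Then the following are equivalent: (i) $\omega_c(\beta_{t_i},\beta_{t_j})\ge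 0$ for all $i\le j$, with strict inequality holding unless $t_i$ and $t_j$ commute. (ii) $w$ is $c$-sortable and $a_1\cdots a_k$ can be converted to a $c$-sorting word for $w$ by a sequence of transpositions of adjacent commuting letters. -/

import Mathlib

noncomputable section

namespace Cambrian

variable {B W : Type*} [Group W] {M : CoxeterMatrix B}

/-! ### Generalized Cartan matrices and the reflection representation -/

/-- `A` is a (real) generalized Cartan matrix for the Coxeter matrix `M`.
The label `∞` is represented by `M s s' = 0`. -/
structure IsCartanMatrix (M : CoxeterMatrix B) (A : Matrix B B ℝ) : Prop where
  diag : ∀ s, A s s = 2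
  nonpos : ∀ s s', s ≠ s' → A s s' ≤ 0
  mul_of_ne_zero : ∀ s s', s ≠ s' → M s s' ≠ 0 →
    A s s' * A s' s = 4 * Real.cos (Real.pi / (M s s' : ℝ)) ^ 2
  mul_of_eq_zero : ∀ s s', s ≠ s' → M s s' = 0 → 4 ≤ A s s' * A s' s
  zero_iff : ∀ s s', A s s' = 0 ↔ A s' s = 0

/-- `δ` is a symmetrizing function for `A`: it is positive, `δ(s) a_{ss'} = δ(s') a_{s's}`,
and it is constant on simple reflections that are conjugate in the Coxeter group. -/
structure IsSymmetrizer (cs : CoxeterSystem M W) (A : Matrix B B ℝ) (δ : B → ℝ) : Prop where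
  pos : ∀ s, 0 < δ s
  symm : ∀ s s', δ s * A s s' = δ s' * A s' s
  conj : ∀ s s', IsConj (cs.simple s) (cs.simple s') → δ s = δ s'

/-- The simple root `α_s`, a member of the standard basis of `V = B → ℝ`. -/
def simpleRoot [DecidableEq B] (s : B) : B → ℝ := Pi.single s 1

/-- The simple co-root `α_s^∨ = δ(s)⁻¹ α_s`. -/
def simpleCoroot [DecidableEq B] (δ : B → ℝ) (s : B) : B → ℝ := (δ s)⁻¹ • simpleRoot s

/-- The linear functional on `V` with value `a_{ss'}` on `α_{s'}`. -/
def rowForm [Fintype B] (A : Matrix B B ℝ) (s : B) : Module.Dual ℝ (B → ℝ) :=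
  (LinearMap.proj s).comp A.mulVecLin

theorem rowForm_simpleRoot [Fintype B] [DecidableEq B] (A : Matrix B B ℝ) (s s' : B) :
    rowForm A s (simpleRoot s') = A s s' := by
  simp [rowForm, simpleRoot]

theorem rowForm_self [Fintype B] [DecidableEq B] {A : Matrix B B ℝ} (hA : IsCartanMatrix M A)
    (s : B) : rowForm A s (simpleRoot s) = 2 := by
  rw [rowForm_simpleRoot, hA.diag]

/-- The action of the simple reflection `s` on `V`:
`s(α_{s'}) = α_{s'} - a_{ss'} α_s`. -/
def simpleAction [Fintype B] [DecidableEq B] {A : Matrix B B ℝ} (hA : IsCartanMatrix M A)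
    (s : B) : (B → ℝ) ≃ₗ[ℝ] (B → ℝ) :=
  Module.reflection (rowForm_self hA s)

theorem simpleAction_simpleRoot [Fintype B] [DecidableEq B] {A : Matrix B B ℝ}
    (hA : IsCartanMatrix M A) (s s' : B) :
    simpleAction hA s (simpleRoot s') = simpleRoot s' - A s s' • simpleRoot s := by
  rw [simpleAction, Module.reflection_apply, rowForm_simpleRoot]

/-- The product of two reflections with `f(y) g(x) = 4 cos² (π / m)` has order dividing `m`. -/
theorem reflection_mul_pow {V : Type*} [AddCommGroup V] [Module ℝ V] {x y : V}
    {f g : Module.Dual ℝ V} (hf : f x = 2) (hg : g y = 2) (m : ℕ) (hm : 2 ≤ m)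
    (h : f y * g x = 4 * Real.cos (Real.pi / (m : ℝ)) ^ 2) (h0 : f y = 0 ↔ g x = 0) :
    (Module.reflection hf * Module.reflection hg) ^ m = 1 := by
  rcases hm.eq_or_lt with rfl | hm3
  · have hz : f y = 0 ∧ g x = 0 := by
      have : f y * g x = 0 := by rw [h]; simp
      rcases mul_eq_zero.1 this with h1 | h1
      · exact ⟨h1, h0.1 h1⟩
      · exact ⟨h0.2 h1, h1⟩
    ext z
    simp only [pow_two, LinearEquiv.mul_apply, Module.reflection_apply, map_sub, map_smul, hz.1,
      hz.2, hf, hg, LinearEquiv.coe_one, id_eq]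
    module
  · have hmR : (3 : ℝ) ≤ m := by exact_mod_cast hm3
    have hm0 : (m : ℝ) ≠ 0 := by positivity
    set θ : ℝ := 2 * (Real.pi / m) with hθ
    have hmθ : (m : ℝ) * θ = 2 * Real.pi := by rw [hθ]; field_simp
    have hsin : Real.sin θ ≠ 0 := by
      apply ne_of_gt
      apply Real.sin_pos_of_pos_of_lt_pi
      · have := Real.pi_pos
        positivity
      · have := Real.pi_pos
        nlinarith
    have ht : 2 * Real.cos θ = f y * g x - 2 := by
      rw [h, hθ, Real.cos_two_mul]; ring
    have hS (k : ℤ) : (Polynomial.Chebyshev.S ℝ k).eval (2 * Real.cos θ)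
        = Real.sin ((k + 1) * θ) / Real.sin θ := by
      rw [eq_div_iff hsin]
      exact Polynomial.Chebyshev.S_two_mul_real_cos θ k
    ext z
    rw [Module.reflection_mul_reflection_pow_apply hf hg m z _ ht]
    rcases Nat.even_or_odd' m with ⟨k, rfl | rfl⟩
    · have e1 : (((2 * k : ℕ) : ℤ) - 2) / 2 = (k : ℤ) - 1 := by omega
      have e2 : (((2 * k : ℕ) : ℤ) - 1) / 2 = (k : ℤ) - 1 := by omega
      have hk : (k : ℝ) * θ = Real.pi := by push_cast at hmθ; linarith
      have hz : (Polynomial.Chebyshev.S ℝ ((k : ℤ) - 1)).eval (2 * Real.cos θ) = 0 := by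
        rw [hS]; push_cast; rw [sub_add_cancel, hk]; simp
      rw [e1, e2, hz]
      simp
    · have e1 : (((2 * k + 1 : ℕ) : ℤ) - 1) / 2 = (k : ℤ) := by omega
      have e2 : (((2 * k + 1 : ℕ) : ℤ) - 3) / 2 = (k : ℤ) - 1 := by omega
      have e3 : (((2 * k + 1 : ℕ) : ℤ)) / 2 = (k : ℤ) := by omega
      have e4 : (((2 * k + 1 : ℕ) : ℤ) - 2) / 2 = (k : ℤ) - 1 := by omega
      have hk : ((k : ℝ) + 1) * θ = 2 * Real.pi - k * θ := by push_cast at hmθ; linarith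
      have hz : (Polynomial.Chebyshev.S ℝ (k : ℤ)).eval (2 * Real.cos θ)
          + (Polynomial.Chebyshev.S ℝ ((k : ℤ) - 1)).eval (2 * Real.cos θ) = 0 := by
        rw [hS, hS]; push_cast
        rw [sub_add_cancel, hk, Real.sin_two_pi_sub]; ring
      rw [e1, e2, e3, e4, hz]
      simp

theorem simpleAction_isLiftable [Fintype B] [DecidableEq B] {A : Matrix B B ℝ}
    (hA : IsCartanMatrix M A) : M.IsLiftable (simpleAction hA) := by
  intro s s'
  by_cases hs : s = s'
  · subst hs
    rw [M.diagonal, pow_one]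
    ext1 v
    exact Module.involutive_reflection (rowForm_self hA s) v
  · by_cases h0 : M s s' = 0
    · rw [h0, pow_zero]
    · have h1 : M s s' ≠ 1 := M.off_diagonal s s' hs
      apply reflection_mul_pow (rowForm_self hA s) (rowForm_self hA s') _ (by omega)
      · rw [rowForm_simpleRoot, rowForm_simpleRoot]
        exact hA.mul_of_ne_zero s s' hs h0
      · rw [rowForm_simpleRoot, rowForm_simpleRoot]
        exact hA.zero_iff s s'

/-- The reflection representation of `W` on `V` determined by the Cartan matrix `A`. -/
def reflRep [Fintype B] [DecidableEq B] (cs : CoxeterSystem M W) {A : Matrix B B ℝ}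
    (hA : IsCartanMatrix M A) : W →* ((B → ℝ) ≃ₗ[ℝ] (B → ℝ)) :=
  cs.lift ⟨simpleAction hA, simpleAction_isLiftable hA⟩

theorem reflRep_simple [Fintype B] [DecidableEq B] (cs : CoxeterSystem M W) {A : Matrix B B ℝ}
    (hA : IsCartanMatrix M A) (s s' : B) :
    reflRep cs hA (cs.simple s) (simpleRoot s') = simpleRoot s' - A s s' • simpleRoot s := by
  rw [reflRep, cs.lift_apply_simple, simpleAction_simpleRoot]

/-- `β` is a positive root of the reflection `t`: for some `w ∈ W` and `s ∈ S` one has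
`t = w s w⁻¹` and `β = w α_s`, and all coordinates of `β` in the basis of simple roots are
nonnegative. -/
def IsPositiveRootOf [Fintype B] [DecidableEq B] (cs : CoxeterSystem M W) {A : Matrix B B ℝ}
    (hA : IsCartanMatrix M A) (t : W) (β : B → ℝ) : Prop :=
  (∃ (w : W) (s : B), t = w * cs.simple s * w⁻¹ ∧ β = reflRep cs hA w (simpleRoot s)) ∧
    ∀ r, 0 ≤ β r

/-- The positive root `β_t` of a reflection `t`. (If `A` is symmetrizable, every reflection has
exactly one positive root. The value at an element that is not a reflection is irrelevant.) -/
def posRoot [Fintype B] [DecidableEq B] (cs : CoxeterSystem M W) {A : Matrix B B ℝ}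
    (hA : IsCartanMatrix M A) (t : W) : B → ℝ :=
  Classical.epsilon fun β => IsPositiveRootOf cs hA t β

/-! ### Coxeter elements, the Euler form and its skew-symmetrization -/

/-- The word `l` lists every simple generator exactly once; the elements represented by such
words are the Coxeter elements. -/
def IsCoxeterWord (l : List B) : Prop := l.Nodup ∧ ∀ s, s ∈ l

/-- The Euler form `E_c`, for `c` represented by the word `l = s_1 ⋯ s_n`. It is given here by its
matrix on simple roots; see `eulerForm_simpleCoroot_simpleRoot` for its values on simple co-roots
and simple roots. -/
def eulerForm [Fintype B] [DecidableEq B] (A : Matrix B B ℝ) (δ : B → ℝ) (l : List B) :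
    LinearMap.BilinForm ℝ (B → ℝ) :=
  Matrix.toBilin' (Matrix.of fun s s' =>
    δ s * if l.idxOf s' < l.idxOf s then A s s' else if s = s' then 1 else 0)

/-- For `s = s_i` and `s' = s_j`, the value `E_c(α_s^∨, α_{s'})` is `a_{ss'}` if `i > j`,
`1` if `i = j`, and `0` if `i < j`. -/
theorem eulerForm_simpleCoroot_simpleRoot [Fintype B] [DecidableEq B] (A : Matrix B B ℝ)
    (δ : B → ℝ) (hδ : ∀ s, 0 < δ s) (l : List B) (s s' : B) :
    eulerForm A δ l (simpleCoroot δ s) (simpleRoot s') =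
      if l.idxOf s' < l.idxOf s then A s s' else if s = s' then 1 else 0 := by
  have h := (hδ s).ne'
  rw [simpleCoroot, map_smul, LinearMap.smul_apply, eulerForm, simpleRoot, simpleRoot,
    Matrix.toBilin'_single, Matrix.of_apply, smul_eq_mul, inv_mul_cancel_left₀ h]

/-- The skew-symmetric form `ω_c(β, β') = E_c(β, β') - E_c(β', β)`. -/
def omegaForm [Fintype B] [DecidableEq B] (A : Matrix B B ℝ) (δ : B → ℝ) (l : List B)
    (β β' : B → ℝ) : ℝ :=
  eulerForm A δ l β β' - eulerForm A δ l β' β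

/-! ### Sorting words and sortable elements -/

/-- The subword of the half-infinite word `(s_1 ⋯ s_n)^∞`, where `l = s_1 ⋯ s_n`, in the positions
`P` (counted from `0`) is `a`. -/
def Spells (l : List B) (P : List ℕ) (a : List B) : Prop :=
  List.Forall₂ (fun p b => l[p % l.length]? = some b) P a

/-- The increasing sequence of positions `P` in `(s_1 ⋯ s_n)^∞` carries the subword `a`, which is
a reduced word for `w`. -/
def IsReducedSubword (cs : CoxeterSystem M W) (l : List B) (w : W) (P : List ℕ) (a : List B) :
    Prop :=
  P.Pairwise (· < ·) ∧ Spells l P a ∧ cs.IsReduced a ∧ cs.wordProd a = w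

/-- `a` is the `(s_1 ⋯ s_n)`-sorting word for `w`, in positions `P`: the lexicographically first
(as a sequence of positions) subword of `(s_1 ⋯ s_n)^∞` that is a reduced word for `w`. -/
def IsSortingWordAt (cs : CoxeterSystem M W) (l : List B) (w : W) (P : List ℕ) (a : List B) :
    Prop :=
  IsReducedSubword cs l w P a ∧
    ∀ Q b, IsReducedSubword cs l w Q b → P = Q ∨ List.Lex (· < ·) P Q

/-- `a` is a `c`-sorting word for `w`: it is the `(s_1 ⋯ s_n)`-sorting word for `w` for some
reduced word `s_1 ⋯ s_n` for `c`. -/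
def IsSortingWord (cs : CoxeterSystem M W) (c w : W) (a : List B) : Prop :=
  ∃ l : List B, cs.IsReduced l ∧ cs.wordProd l = c ∧ ∃ P, IsSortingWordAt cs l w P a

/-- The set of letters in the `k`-th copy of `s_1 ⋯ s_n` (between adjacent dividers) which occur
at one of the positions `P`. -/
def block (l : List B) (P : List ℕ) (k : ℕ) : Set B :=
  {b | ∃ p ∈ P, p / l.length = k ∧ l[p % l.length]? = some b}

/-- `w` is `c`-sortable: a `c`-sorting word for `w` defines a sequence of subsets of `S` which is
weakly decreasing under inclusion. -/
def IsSortable (cs : CoxeterSystem M W) (c w : W) : Prop :=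
  ∃ l : List B, cs.IsReduced l ∧ cs.wordProd l = c ∧
    ∃ P a, IsSortingWordAt cs l w P a ∧ Antitone (block l P)

/-- `b` arises from `a` by transposing two adjacent letters that commute in `W`. -/
def CommutationMove (cs : CoxeterSystem M W) (a b : List B) : Prop :=
  ∃ (x y : List B) (s s' : B), Commute (cs.simple s) (cs.simple s') ∧
    a = x ++ s :: s' :: y ∧ b = x ++ s' :: s :: y

end Cambrian

end

namespace Cambrian

open CoxeterSystem

/-! ### Coordinates of simple roots. -/

section

variable {B : Type*} [DecidableEq B]

/-! Both conditions obey the same recursion on the first letter `s` of the Coxeter word; the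
induction runs over partial Coxeter words `l` without repeated letters. If `s` does not occur in
`a`, the roots of `a` have zero `s`-coordinate and `s` can be dropped from `l`. If `s` occurs, it
must be movable to the front of `a` by commutations. Deleting it moves `s` to the end of `l`, and
the reflection `s` carries one form ω to the other (`omegaForm_rotate`). The inequalities with α_s
on the left are then automatic, because ω(α_s, β) = δ(s)(β_s + (sβ)_s). `IsSortableWord` encodes
this recursion combinatorially; `IsAligned` is condition (i), with commuting reflections replaced by
orthogonal roots.

The heart is `IsAligned.isLeftDescent_of_mem`. Let a = x s y with `s` not in `x`, and γ = xα_s. Then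
γ - α_s is a nonnegative combination of roots of `x`, so alignment gives ω(γ - α_s, γ) ≥ 0. By
skew-symmetry, and because `s` comes first, this number equals K(α_s, γ - α_s), where K is the
invariant symmetric form. But γ - α_s has nonnegative coordinates and no `s`-coordinate, so the
number is also ≤ 0, and equality forces all letters of `x` to commute with `s`.

Sorting words satisfy the recursion through shifts of positions (`IsSortingWordAt.isSortableWord`,
`IsSortableWord.exists_isSortingWordAt`). Different reduced words for c differ by commutations
(`commutation_of_wordProd_eq_nodup`), which leave ω unchanged, so alignment mediates between the
choices of word allowed in (ii). Underneath lies the positivity of roots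
(`reflRep_simpleRoot_nonneg`). -/

theorem simpleRoot_nonneg (s : B) : 0 ≤ simpleRoot s := by
  intro r
  by_cases h : r = s
  · subst h; simp [simpleRoot]
  · simp [simpleRoot, h]

theorem simpleRoot_apply_self (s : B) : simpleRoot s s = 1 := by simp [simpleRoot]

theorem simpleRoot_apply_of_ne {s r : B} (h : r ≠ s) : simpleRoot s r = 0 := by simp [simpleRoot, h]

theorem simpleRoot_injective : Function.Injective (simpleRoot (B := B)) := by
  intro s r h
  by_contra hne
  have := congrFun h s
  rw [simpleRoot_apply_self, simpleRoot_apply_of_ne hne] at this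
  exact one_ne_zero this

end

/-- Strip right descents in {s, t} until none remain. Since `s` is not a descent at the start, the
stripped letters form a single alternating word ending in `t`. -/
theorem exists_mul_alternatingWord {B W : Type*} [Group W] {M : CoxeterMatrix B}
    {cs : CoxeterSystem M W} (n : ℕ) : ∀ (w : W) (s t : B), cs.length w = n →
    ¬ cs.IsRightDescent w s → ∃ v k, w = v * cs.wordProd (alternatingWord s t k) ∧
      cs.length w = cs.length v + k ∧ ¬ cs.IsRightDescent v s ∧ ¬ cs.IsRightDescent v t := by
  induction n using Nat.strong_induction_on with
  | _ n ih =>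
    intro w s t hn hs
    by_cases ht : cs.IsRightDescent w t
    · have hl := cs.isRightDescent_iff.1 ht
      -- Once `t` is removed it is no longer a descent, so the two letters exchange roles.
      obtain ⟨v, k, h1, h2, h3, h4⟩ := ih (cs.length (w * cs.simple t)) (by omega)
        (w * cs.simple t) t s rfl (cs.isRightDescent_iff_not_isRightDescent_mul.1 ht)
      refine ⟨v, k + 1, ?_, by omega, h4, h3⟩
      rw [alternatingWord_succ, wordProd_concat, ← mul_assoc, ← h1,
        cs.simple_mul_simple_cancel_right]
    · exact ⟨w, 0, by simp [alternatingWord], rfl, hs, ht⟩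

variable {B W : Type*} [Fintype B] [DecidableEq B] [Group W] {M : CoxeterMatrix B}
  (cs : CoxeterSystem M W) {A : Matrix B B ℝ} (hA : IsCartanMatrix M A) {δ : B → ℝ}

/-! ### The invariant symmetric form and the reflection representation -/

theorem reflRep_simple_apply (s : B) (v : B → ℝ) :
    reflRep cs hA (cs.simple s) v = v - rowForm A s v • simpleRoot s := by
  rw [reflRep, cs.lift_apply_simple, simpleAction, Module.reflection_apply]

theorem reflRep_mul_apply (u w : W) (v : B → ℝ) :
    reflRep cs hA (u * w) v = reflRep cs hA u (reflRep cs hA w v) := by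
  rw [map_mul, LinearEquiv.mul_apply]

theorem reflRep_inv_apply_apply (w : W) (v : B → ℝ) :
    reflRep cs hA w⁻¹ (reflRep cs hA w v) = v := by
  rw [← reflRep_mul_apply, inv_mul_cancel, map_one, LinearEquiv.coe_one, id]

theorem reflRep_apply_inv_apply (w : W) (v : B → ℝ) :
    reflRep cs hA w (reflRep cs hA w⁻¹ v) = v := by
  rw [← reflRep_mul_apply, mul_inv_cancel, map_one, LinearEquiv.coe_one, id]

theorem reflRep_simple_self (s : B) :
    reflRep cs hA (cs.simple s) (simpleRoot s) = -simpleRoot s := by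
  rw [reflRep_simple, hA.diag]; module

theorem reflRep_simple_apply_of_ne (s : B) (v : B → ℝ) {r : B} (h : r ≠ s) :
    reflRep cs hA (cs.simple s) v r = v r := by
  simp [reflRep_simple_apply, simpleRoot, h]

theorem reflRep_wordProd_apply_of_notMem {a : List B} {r : B} (h : r ∉ a) (v : B → ℝ) :
    reflRep cs hA (cs.wordProd a) v r = v r := by
  induction a with
  | nil => simp
  | cons s a ih =>
    rw [List.mem_cons, not_or] at h
    rw [wordProd_cons, reflRep_mul_apply, reflRep_simple_apply_of_ne cs hA _ _ h.1, ih h.2]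

/-- The symmetric bilinear form with matrix `δ(s) a_{ss'}`. -/
def cartanForm (A : Matrix B B ℝ) (δ : B → ℝ) : LinearMap.BilinForm ℝ (B → ℝ) :=
  Matrix.toBilin' (Matrix.of fun s s' => δ s * A s s')

theorem cartanForm_simpleRoot_simpleRoot (s s' : B) :
    cartanForm A δ (simpleRoot s) (simpleRoot s') = δ s * A s s' := by
  rw [cartanForm, simpleRoot, simpleRoot, Matrix.toBilin'_single, Matrix.of_apply]

theorem cartanForm_simpleRoot_left (s : B) (v : B → ℝ) :
    cartanForm A δ (simpleRoot s) v = δ s * rowForm A s v := by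
  have : cartanForm A δ (simpleRoot s) = δ s • rowForm A s := by
    refine LinearMap.pi_ext' fun r => LinearMap.ext_ring ?_
    have := cartanForm_simpleRoot_simpleRoot (A := A) (δ := δ) s r
    have h2 := rowForm_simpleRoot A s r
    simp only [simpleRoot] at this h2
    simp [simpleRoot, this, h2]
  rw [this]; simp

variable {cs}

theorem cartanForm_comm (hδ : IsSymmetrizer cs A δ) (v v' : B → ℝ) :
    cartanForm A δ v v' = cartanForm A δ v' v := by
  simp only [cartanForm, Matrix.toBilin'_apply, Matrix.of_apply]
  rw [Finset.sum_comm]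
  refine Finset.sum_congr rfl fun i _ => Finset.sum_congr rfl fun j _ => ?_
  rw [hδ.symm j i]; ring

theorem cartanForm_reflRep (hδ : IsSymmetrizer cs A δ) (w : W) (v v' : B → ℝ) :
    cartanForm A δ (reflRep cs hA w v) (reflRep cs hA w v') = cartanForm A δ v v' := by
  induction w using cs.simple_induction_left with
  | one => simp
  | mul_simple_left w s ih =>
    rw [reflRep_mul_apply, reflRep_mul_apply, ← ih, reflRep_simple_apply, reflRep_simple_apply]
    simp only [map_sub, map_smul, LinearMap.sub_apply, LinearMap.smul_apply, smul_eq_mul]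
    rw [cartanForm_comm hδ _ (simpleRoot s)]
    simp only [cartanForm_simpleRoot_left, rowForm_self hA]
    ring

theorem cartanForm_reflRep_simpleRoot_self (hδ : IsSymmetrizer cs A δ) (w : W) (s : B) :
    cartanForm A δ (reflRep cs hA w (simpleRoot s)) (reflRep cs hA w (simpleRoot s)) = 2 * δ s := by
  rw [cartanForm_reflRep hA hδ, cartanForm_simpleRoot_simpleRoot, hA.diag, mul_comm]

theorem reflRep_conj_apply (hδ : IsSymmetrizer cs A δ) (w : W) (s : B) (v : B → ℝ) :
    reflRep cs hA (w * cs.simple s * w⁻¹) v =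
      v - ((δ s)⁻¹ * cartanForm A δ (reflRep cs hA w (simpleRoot s)) v) •
        reflRep cs hA w (simpleRoot s) := by
  have h : cartanForm A δ (reflRep cs hA w (simpleRoot s)) v =
      δ s * rowForm A s (reflRep cs hA w⁻¹ v) := by
    rw [← cartanForm_simpleRoot_left, ← cartanForm_reflRep hA hδ w _ (reflRep cs hA w⁻¹ v),
      reflRep_apply_inv_apply]
  rw [h, inv_mul_cancel_left₀ (hδ.pos s).ne', reflRep_mul_apply, reflRep_mul_apply,
    reflRep_simple_apply, map_sub, map_smul, reflRep_apply_inv_apply]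

/-! ### Positivity of roots -/

/-- The solutions of the recursion `x_{k+2} = τ x_{k+1} - x_k` that describe roots of a dihedral
group stay nonnegative up to the order of the group. -/
theorem exists_dihedral_sequence {τ : ℝ} {m : ℕ}
    (h : (m = 0 ∧ 2 ≤ τ) ∨ (2 ≤ m ∧ τ = 2 * Real.cos (Real.pi / m))) :
    ∃ x : ℕ → ℝ, x 0 = 0 ∧ x 1 = 1 ∧ (∀ k, x (k + 2) = τ * x (k + 1) - x k) ∧
      ∀ k, (m = 0 ∨ k ≤ m) → 0 ≤ x k := by
  rcases h with ⟨rfl, hτ⟩ | ⟨hm, hτ⟩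
  -- The pair is (x_k, x_{k+1}); for τ ≥ 2 the sequence is nondecreasing.
  · let f : ℕ → ℝ × ℝ := fun k => Nat.rec (0, 1) (fun _ p => (p.2, τ * p.2 - p.1)) k
    have hf (k : ℕ) : 0 ≤ (f k).1 ∧ (f k).1 ≤ (f k).2 := by
      induction k with
      | zero => exact ⟨le_rfl, zero_le_one⟩
      | succ k ih =>
        refine ⟨ih.1.trans ih.2, ?_⟩
        change (f k).2 ≤ τ * (f k).2 - (f k).1
        nlinarith [ih.1, ih.2]
    exact ⟨fun k => (f k).1, rfl, rfl, fun k => rfl, fun k _ => (hf k).1⟩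
  · have hm' : (2 : ℝ) ≤ m := by exact_mod_cast hm
    have hpi := Real.pi_pos
    set θ := Real.pi / m with hθ
    have hmθ : m * θ = Real.pi := by rw [hθ]; field_simp
    have hθ0 : 0 < θ := by positivity
    have hs : 0 < Real.sin θ := Real.sin_pos_of_pos_of_lt_pi hθ0 (by nlinarith)
    refine ⟨fun k => Real.sin (k * θ) / Real.sin θ, by simp, by simp [hs.ne'], fun k => ?_,
      fun k hk => div_nonneg (Real.sin_nonneg_of_nonneg_of_le_pi (by positivity) ?_) hs.le⟩
    · beta_reduce
      have e1 : ((k + 2 : ℕ) : ℝ) * θ = ((k + 1 : ℕ) : ℝ) * θ + θ := by push_cast; ring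
      have e2 : (k : ℝ) * θ = ((k + 1 : ℕ) : ℝ) * θ - θ := by push_cast; ring
      rw [e1, e2, Real.sin_add, Real.sin_sub, hτ]
      ring
    · have hk : (k : ℝ) ≤ m := by exact_mod_cast hk.resolve_left (by omega)
      rw [← hmθ]
      gcongr

theorem reflRep_alternatingWord_nonneg (hδ : IsSymmetrizer cs A δ) {s t : B} (hst : s ≠ t) (k : ℕ)
    (hk : M s t = 0 ∨ k < M s t) :
    ∃ p q : ℝ, 0 ≤ p ∧ 0 ≤ q ∧ reflRep cs hA (cs.wordProd (alternatingWord s t k)) (simpleRoot s) =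
      p • simpleRoot s + q • simpleRoot t := by
  have hs := hδ.pos s
  have ht := hδ.pos t
  -- In the basis α_s, gα_t both off-diagonal Cartan entries become -τ.
  set g := √(δ s / δ t) with hg
  have hg0 : 0 < g := Real.sqrt_pos.2 (by positivity)
  have hg2 : g * g * δ t = δ s := by rw [hg, Real.mul_self_sqrt (by positivity)]; field_simp
  set τ := -A t s / g with hτ
  have hts : A t s = -(τ * g) := by rw [hτ]; field_simp
  have hAts := hA.nonpos t s hst.symm
  have hst' : A s t = -(τ / g) := by
    have h1 := hδ.symm s t
    rw [← hg2, hts] at h1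
    have h2 : g * δ t ≠ 0 := by positivity
    rw [eq_neg_iff_add_eq_zero, ← mul_right_inj' h2]
    field_simp
    have h3 : δ t * (g * g * A s t + τ * g) = 0 := by linarith
    have := (mul_eq_zero.1 h3).resolve_left ht.ne'
    have h4 : g * (g * A s t + τ) = 0 := by linarith
    simpa [hg0.ne'] using h4
  have hτ0 : 0 ≤ τ := div_nonneg (by linarith) hg0.le
  have hprod : A s t * A t s = τ * τ := by rw [hst', hts]; field_simp
  have hM1 : M s t ≠ 1 := M.off_diagonal s t hst
  have hτm : (M s t = 0 ∧ 2 ≤ τ) ∨ (2 ≤ M s t ∧ τ = 2 * Real.cos (Real.pi / M s t)) := by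
    by_cases h0 : M s t = 0
    · refine Or.inl ⟨h0, ?_⟩
      have := hA.mul_of_eq_zero s t hst h0
      nlinarith
    · have hm2 : 2 ≤ M s t := by omega
      refine Or.inr ⟨hm2, ?_⟩
      have h1 := hA.mul_of_ne_zero s t hst h0
      have hmR : (2 : ℝ) ≤ M s t := by exact_mod_cast hm2
      have hc : 0 ≤ Real.cos (Real.pi / M s t) := by
        apply Real.cos_nonneg_of_neg_pi_div_two_le_of_le
        · have : 0 ≤ Real.pi / M s t := by have := Real.pi_pos; positivity
          linarith [Real.pi_pos]
        · exact div_le_div_of_nonneg_left Real.pi_pos.le (by norm_num) hmR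
      rw [hprod] at h1
      have h2 : τ ^ 2 = (2 * Real.cos (Real.pi / M s t)) ^ 2 := by rw [sq, h1]; ring
      exact (pow_left_inj₀ hτ0 (by positivity) two_ne_zero).1 h2
  obtain ⟨x, hx0, hx1, hx, hxk⟩ := exists_dihedral_sequence hτm
  -- Each new letter changes only its own coordinate in the basis α_s, gα_t, from x_k to x_{k+2}.
  have key : ∀ k, reflRep cs hA (cs.wordProd (alternatingWord s t k)) (simpleRoot s) =
      if Even k then x (k + 1) • simpleRoot s + (g * x k) • simpleRoot t
      else x k • simpleRoot s + (g * x (k + 1)) • simpleRoot t := by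
    intro k
    induction k with
    | zero => simp [alternatingWord, hx0, hx1]
    | succ k ih =>
      rw [alternatingWord_succ', wordProd_cons, reflRep_mul_apply, ih]
      by_cases he : Even k
      · have : ¬ Even (k + 1) := by simpa [Nat.even_add_one] using he
        simp only [he, this, if_true, if_false]
        rw [map_add, map_smul, map_smul, reflRep_simple_self, reflRep_simple, hts, hx]
        module
      · have : Even (k + 1) := by simpa [Nat.even_add_one] using he
        simp only [he, this, if_true, if_false]
        rw [map_add, map_smul, map_smul, reflRep_simple_self, reflRep_simple, hst', hx]
        match_scalars <;> field_simp
        ring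
  have h1 := hxk k (by omega)
  have h2 := hxk (k + 1) (by omega)
  rw [key]
  split_ifs
  · exact ⟨_, _, h2, by positivity, rfl⟩
  · exact ⟨_, _, h1, by positivity, rfl⟩

theorem reflRep_simpleRoot_ne_zero (w : W) (s : B) : reflRep cs hA w (simpleRoot s) ≠ 0 := by
  intro h
  rw [LinearEquiv.map_eq_zero_iff] at h
  simpa [simpleRoot_apply_self] using congrFun h s

/-- Induction on length. Split off from `w` a dihedral factor ending in a descent `t`: it sends α_s
to a nonnegative combination of α_s and α_t, and the shorter remaining factor has neither `s` nor
`t` as a descent. -/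
theorem reflRep_simpleRoot_nonneg (hδ : IsSymmetrizer cs A δ) {w : W} {s : B}
    (h : ¬ cs.IsRightDescent w s) : 0 ≤ reflRep cs hA w (simpleRoot s) := by
  induction hn : cs.length w using Nat.strong_induction_on generalizing w s with
  | _ n ih =>
    subst hn
    by_cases hw : w = 1
    · subst hw; simpa using simpleRoot_nonneg s
    obtain ⟨t, ht⟩ := cs.exists_rightDescent_of_ne_one hw
    have hst : s ≠ t := by rintro rfl; exact h ht
    obtain ⟨v, k, hwv, hl, hvs, hvt⟩ := exists_mul_alternatingWord _ w s t rfl h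
    have hk0 : k ≠ 0 := by
      rintro rfl
      apply hvt
      have : w = v := by simpa [alternatingWord] using hwv
      rwa [← this]
    -- Were the dihedral factor of length at least m(s,t), appending `s` to it would not be reduced,
    -- although `s` lengthens `w`.
    have hk : M s t = 0 ∨ k < M s t := by
      by_contra! hcon
      have hnr := cs.not_isReduced_alternatingWord t s (m := k + 1)
        (by rw [M.symmetric]; exact hcon.1) (by rw [M.symmetric]; omega)
      have h1 := cs.not_isRightDescent_iff.1 h
      have h2 : w * cs.simple s = v * cs.wordProd (alternatingWord t s (k + 1)) := by
        rw [alternatingWord_succ, wordProd_concat, hwv, mul_assoc]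
      have h3 := cs.length_mul_le v (cs.wordProd (alternatingWord t s (k + 1)))
      have h4 := cs.length_wordProd_le (alternatingWord t s (k + 1))
      rw [CoxeterSystem.IsReduced, length_alternatingWord] at hnr
      rw [length_alternatingWord] at h4
      rw [← h2] at h3
      omega
    obtain ⟨p, q, hp, hq, hpq⟩ := reflRep_alternatingWord_nonneg hA hδ hst k hk
    rw [hwv, reflRep_mul_apply, hpq, map_add, map_smul, map_smul]
    exact add_nonneg (smul_nonneg hp (ih _ (by omega) hvs rfl))
      (smul_nonneg hq (ih _ (by omega) hvt rfl))

theorem reflRep_simpleRoot_nonpos (hδ : IsSymmetrizer cs A δ) {w : W} {s : B}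
    (h : cs.IsRightDescent w s) : reflRep cs hA w (simpleRoot s) ≤ 0 := by
  have := reflRep_simpleRoot_nonneg hA hδ (cs.isRightDescent_iff_not_isRightDescent_mul.1 h)
  rw [reflRep_mul_apply, reflRep_simple_self, map_neg] at this
  exact neg_nonneg.1 this

theorem not_isRightDescent_of_apply_pos (hδ : IsSymmetrizer cs A δ) {w : W} {s r : B}
    (h : 0 < reflRep cs hA w (simpleRoot s) r) : ¬ cs.IsRightDescent w s :=
  fun h' => h.not_ge (reflRep_simpleRoot_nonpos hA hδ h' r)

theorem reflRep_injective (hδ : IsSymmetrizer cs A δ) : Function.Injective (reflRep cs hA) := by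
  rw [injective_iff_map_eq_one]
  intro w hw
  by_contra hne
  obtain ⟨s, hs⟩ := cs.exists_rightDescent_of_ne_one hne
  have := reflRep_simpleRoot_nonpos hA hδ hs s
  rw [hw] at this
  simp only [LinearEquiv.coe_one, id, simpleRoot_apply_self, Pi.zero_apply] at this
  linarith

end Cambrian

namespace Cambrian

open CoxeterSystem

/-! ### Reduced words and descents. -/

section

variable {B W : Type*} [Group W] {M : CoxeterMatrix B} {cs : CoxeterSystem M W}

theorem IsReduced.left {x y : List B} (h : cs.IsReduced (x ++ y)) : cs.IsReduced x := by
  simpa using h.take x.length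

theorem IsReduced.right {x y : List B} (h : cs.IsReduced (x ++ y)) : cs.IsReduced y := by
  simpa using h.drop x.length

theorem IsReduced.not_isRightDescent {x y : List B} {r : B} (h : cs.IsReduced (x ++ r :: y)) :
    ¬ cs.IsRightDescent (cs.wordProd x) r := by
  have h1 : cs.IsReduced (x ++ [r]) := by
    rw [← List.singleton_append, ← List.append_assoc] at h
    exact IsReduced.left h
  have h2 := IsReduced.left h1
  unfold CoxeterSystem.IsReduced at h1 h2
  rw [← List.concat_eq_append, wordProd_concat, List.length_concat, ← h2] at h1
  exact cs.not_isRightDescent_iff.2 h1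

theorem IsReduced.isLeftDescent {s : B} {y : List B} (h : cs.IsReduced (s :: y)) :
    cs.IsLeftDescent (cs.wordProd (s :: y)) s := by
  have h2 := cs.length_wordProd_le y
  unfold CoxeterSystem.IsReduced at h
  rw [List.length_cons] at h
  rw [IsLeftDescent, h, wordProd_cons, cs.simple_mul_simple_cancel_left]
  omega

end

variable {B W : Type*} [Fintype B] [DecidableEq B] [Group W] {M : CoxeterMatrix B}
  {cs : CoxeterSystem M W} {A : Matrix B B ℝ} (hA : IsCartanMatrix M A) {δ : B → ℝ}

/-! ### Reflections and their roots -/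

/-- Comparing norms gives δ(s') = μ²δ(s), so the two reflection formulas agree and the reflections
coincide by faithfulness. Then `s` and `s'` are conjugate, and constancy of δ on conjugate
generators gives μ² = 1. -/
theorem conj_simple_eq_of_root_eq_smul (hδ : IsSymmetrizer cs A δ) {w w' : W} {s s' : B} {μ : ℝ}
    (h : reflRep cs hA w' (simpleRoot s') = μ • reflRep cs hA w (simpleRoot s)) :
    w' * cs.simple s' * w'⁻¹ = w * cs.simple s * w⁻¹ ∧ (0 ≤ μ → μ = 1) := by
  have hs := hδ.pos s
  have hs' := hδ.pos s'
  have hK : δ s' = μ * μ * δ s := by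
    have h1 := cartanForm_reflRep_simpleRoot_self hA hδ w' s'
    rw [h, map_smul, map_smul, LinearMap.smul_apply,
      cartanForm_reflRep_simpleRoot_self hA hδ w s, smul_eq_mul, smul_eq_mul] at h1
    linarith
  have hμ : μ ≠ 0 := by rintro rfl; simp at hK; linarith
  have ht : w' * cs.simple s' * w'⁻¹ = w * cs.simple s * w⁻¹ := by
    apply reflRep_injective hA hδ
    ext1 v
    rw [reflRep_conj_apply hA hδ, reflRep_conj_apply hA hδ, h, map_smul, LinearMap.smul_apply,
      smul_smul, hK, smul_eq_mul]
    congr 2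
    field_simp
  refine ⟨ht, fun h0 => ?_⟩
  have hc : IsConj (cs.simple s) (cs.simple s') := by
    rw [isConj_iff]
    refine ⟨w'⁻¹ * w, ?_⟩
    have : cs.simple s' = w'⁻¹ * (w' * cs.simple s' * w'⁻¹) * w' := by group
    rw [this, ht]; group
  rw [hδ.conj s s' hc] at hK
  have h2 : (μ - 1) * (μ + 1) = 0 := by
    have : δ s' * ((μ - 1) * (μ + 1)) = 0 := by linarith
    exact (mul_eq_zero.1 this).resolve_left hs'.ne'
  rcases mul_eq_zero.1 h2 with h3 | h3 <;> linarith

/-- The (-1)-eigenspace of a reflection is a line, so the roots are proportional. A negative factor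
is made positive by passing from `w'` to `w's'`. -/
theorem root_eq_or_eq_neg_of_conj_eq (hδ : IsSymmetrizer cs A δ) {w w' : W} {s s' : B}
    (h : w' * cs.simple s' * w'⁻¹ = w * cs.simple s * w⁻¹) :
    reflRep cs hA w' (simpleRoot s') = reflRep cs hA w (simpleRoot s) ∨
      reflRep cs hA w' (simpleRoot s') = -reflRep cs hA w (simpleRoot s) := by
  have h1 : reflRep cs hA (w' * cs.simple s' * w'⁻¹) (reflRep cs hA w' (simpleRoot s')) =
      -reflRep cs hA w' (simpleRoot s') := by
    rw [reflRep_mul_apply, reflRep_inv_apply_apply, reflRep_mul_apply, reflRep_simple_self, map_neg]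
  rw [h, reflRep_conj_apply hA hδ] at h1
  obtain ⟨μ, hμ⟩ : ∃ μ : ℝ,
      reflRep cs hA w' (simpleRoot s') = μ • reflRep cs hA w (simpleRoot s) := by
    set c := (δ s)⁻¹ * cartanForm A δ (reflRep cs hA w (simpleRoot s))
      (reflRep cs hA w' (simpleRoot s'))
    refine ⟨c / 2, ?_⟩
    have h2 : (2 : ℝ) • reflRep cs hA w' (simpleRoot s') =
        c • reflRep cs hA w (simpleRoot s) := by
      rw [two_smul]; rw [sub_eq_iff_eq_add] at h1
      nth_rw 1 [h1]; abel
    rw [div_eq_inv_mul, mul_smul, ← h2, smul_smul]; norm_num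
  by_cases h0 : 0 ≤ μ
  · left
    rw [hμ, (conj_simple_eq_of_root_eq_smul hA hδ hμ).2 h0, one_smul]
  · right
    have hneg : reflRep cs hA (w' * cs.simple s') (simpleRoot s') =
        (-μ) • reflRep cs hA w (simpleRoot s) := by
      rw [reflRep_mul_apply, reflRep_simple_self, map_neg, hμ, neg_smul]
    have := (conj_simple_eq_of_root_eq_smul hA hδ hneg).2 (by linarith)
    rw [hμ, ← neg_eq_iff_eq_neg, ← neg_smul, this, one_smul]

theorem root_eq_of_conj_eq (hδ : IsSymmetrizer cs A δ) {w w' : W} {s s' : B}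
    (h : w' * cs.simple s' * w'⁻¹ = w * cs.simple s * w⁻¹)
    (h0 : 0 ≤ reflRep cs hA w (simpleRoot s)) (h0' : 0 ≤ reflRep cs hA w' (simpleRoot s')) :
    reflRep cs hA w' (simpleRoot s') = reflRep cs hA w (simpleRoot s) := by
  rcases root_eq_or_eq_neg_of_conj_eq hA hδ h with h1 | h1
  · exact h1
  · rw [h1] at h0'
    exact absurd (le_antisymm (neg_nonneg.1 h0') h0) (reflRep_simpleRoot_ne_zero hA w s)

theorem commute_conj_simple_of_cartanForm_eq_zero (hδ : IsSymmetrizer cs A δ) {w w' : W} {s s' : B}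
    (h : cartanForm A δ (reflRep cs hA w (simpleRoot s)) (reflRep cs hA w' (simpleRoot s')) = 0) :
    Commute (w * cs.simple s * w⁻¹) (w' * cs.simple s' * w'⁻¹) := by
  apply reflRep_injective hA hδ
  ext1 v
  have h' := h
  rw [cartanForm_comm hδ] at h'
  simp only [reflRep_mul_apply cs hA (w * cs.simple s * w⁻¹),
    reflRep_mul_apply cs hA (w' * cs.simple s' * w'⁻¹), reflRep_conj_apply hA hδ, map_sub, map_smul,
    h, h', smul_zero, sub_zero]
  abel

/-- The first reflection sends the second root to plus or minus itself. The plus sign means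
orthogonality; the minus sign makes the roots proportional and the reflections equal. -/
theorem cartanForm_eq_zero_of_commute (hδ : IsSymmetrizer cs A δ) {w w' : W} {s s' : B}
    (h : Commute (w * cs.simple s * w⁻¹) (w' * cs.simple s' * w'⁻¹))
    (hne : w * cs.simple s * w⁻¹ ≠ w' * cs.simple s' * w'⁻¹) :
    cartanForm A δ (reflRep cs hA w (simpleRoot s)) (reflRep cs hA w' (simpleRoot s')) = 0 := by
  have h1 : (w * cs.simple s * w⁻¹ * w') * cs.simple s' * (w * cs.simple s * w⁻¹ * w')⁻¹ =
      w' * cs.simple s' * w'⁻¹ := by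
    rw [mul_inv_rev, ← mul_assoc, mul_assoc (w * cs.simple s * w⁻¹) w',
      mul_assoc (w * cs.simple s * w⁻¹), h.eq, mul_inv_cancel_right]
  have h2 := root_eq_or_eq_neg_of_conj_eq hA hδ h1
  rw [reflRep_mul_apply, reflRep_conj_apply hA hδ] at h2
  have hs := (hδ.pos s).ne'
  rcases h2 with h2 | h2
  · rw [sub_eq_self, smul_eq_zero] at h2
    simpa [hs] using h2.resolve_right (reflRep_simpleRoot_ne_zero hA w s)
  · exfalso
    set c := (δ s)⁻¹ * cartanForm A δ (reflRep cs hA w (simpleRoot s))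
      (reflRep cs hA w' (simpleRoot s'))
    have h3 : reflRep cs hA w' (simpleRoot s') = (c / 2) • reflRep cs hA w (simpleRoot s) := by
      have h4 : (2 : ℝ) • reflRep cs hA w' (simpleRoot s') =
          c • reflRep cs hA w (simpleRoot s) := by
        rw [two_smul]; rw [sub_eq_iff_eq_add] at h2
        nth_rw 1 [h2]; abel
      rw [div_eq_inv_mul, mul_smul, ← h4, smul_smul]; norm_num
    exact hne (conj_simple_eq_of_root_eq_smul hA hδ h3).1.symm

theorem simple_injective (hA : IsCartanMatrix M A) (hδ : IsSymmetrizer cs A δ) : Function.Injective cs.simple := by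
  intro s r h
  have := root_eq_of_conj_eq hA hδ (w := 1) (w' := 1) (s := r) (s' := s) (by simpa using h)
    (by simpa using simpleRoot_nonneg r) (by simpa using simpleRoot_nonneg s)
  exact simpleRoot_injective (by simpa using this)

theorem commute_simple_of_eq_zero (hA : IsCartanMatrix M A) (hδ : IsSymmetrizer cs A δ) {s r : B} (h : A s r = 0) :
    Commute (cs.simple s) (cs.simple r) := by
  have := commute_conj_simple_of_cartanForm_eq_zero hA hδ (w := 1) (w' := 1) (s := s) (s' := r)
    (by simp [cartanForm_simpleRoot_simpleRoot, h])
  simpa using this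

theorem eq_zero_of_commute_simple (hA : IsCartanMatrix M A) (hδ : IsSymmetrizer cs A δ) {s r : B} (hne : s ≠ r)
    (h : Commute (cs.simple s) (cs.simple r)) : A s r = 0 := by
  have := cartanForm_eq_zero_of_commute hA hδ (w := 1) (w' := 1) (s := s) (s' := r)
    (by simpa using h) (by simpa using (simple_injective hA hδ).ne hne)
  simpa [cartanForm_simpleRoot_simpleRoot, (hδ.pos s).ne'] using this

/-! ### Root sequences of words -/

/-- The sequence of roots `a_1 ⋯ a_{i-1} α_{a_i}` of a word. -/
def rootSeq (cs : CoxeterSystem M W) : List B → List (B → ℝ)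
  | [] => []
  | s :: a => simpleRoot s :: (rootSeq cs a).map (reflRep cs hA (cs.simple s))

theorem rootSeq_append (x y : List B) :
    rootSeq hA cs (x ++ y) =
      rootSeq hA cs x ++ (rootSeq hA cs y).map (reflRep cs hA (cs.wordProd x)) := by
  induction x with
  | nil => simp [rootSeq, Function.id_def]
  | cons s x ih =>
    simp only [List.cons_append, rootSeq, ih, List.map_append, List.map_map, wordProd_cons]
    congr 3
    funext v
    simp

theorem mem_rootSeq {a : List B} {β : B → ℝ} : β ∈ rootSeq hA cs a ↔
    ∃ x r y, a = x ++ r :: y ∧ β = reflRep cs hA (cs.wordProd x) (simpleRoot r) := by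
  constructor
  · intro h
    induction a generalizing β with
    | nil => simp [rootSeq] at h
    | cons s a ih =>
      rw [rootSeq, List.mem_cons, List.mem_map] at h
      rcases h with rfl | ⟨γ, hγ, rfl⟩
      · exact ⟨[], s, a, rfl, by simp⟩
      · obtain ⟨x, r, y, rfl, rfl⟩ := ih hγ
        exact ⟨s :: x, r, y, rfl, by rw [wordProd_cons, reflRep_mul_apply]⟩
  · rintro ⟨x, r, y, rfl, rfl⟩
    rw [rootSeq_append]
    simp [rootSeq]

theorem rootSeq_nonneg (hδ : IsSymmetrizer cs A δ) {a : List B} (ha : cs.IsReduced a) {β : B → ℝ}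
    (h : β ∈ rootSeq hA cs a) : 0 ≤ β := by
  obtain ⟨x, r, y, rfl, rfl⟩ := (mem_rootSeq hA).1 h
  exact reflRep_simpleRoot_nonneg hA hδ (IsReduced.not_isRightDescent ha)

theorem rootSeq_apply_of_notMem {a : List B} {r : B} (hr : r ∉ a) {β : B → ℝ}
    (h : β ∈ rootSeq hA cs a) : β r = 0 := by
  obtain ⟨x, q, y, rfl, rfl⟩ := (mem_rootSeq hA).1 h
  simp only [List.mem_append, List.mem_cons, not_or] at hr
  rw [reflRep_wordProd_apply_of_notMem cs hA hr.1, simpleRoot_apply_of_ne hr.2.1]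

theorem reflRep_simpleRoot_nonneg_or_nonpos (hδ : IsSymmetrizer cs A δ) (w : W) (s : B) :
    0 ≤ reflRep cs hA w (simpleRoot s) ∨ reflRep cs hA w (simpleRoot s) ≤ 0 := by
  by_cases h : cs.IsRightDescent w s
  · exact Or.inr (reflRep_simpleRoot_nonpos hA hδ h)
  · exact Or.inl (reflRep_simpleRoot_nonneg hA hδ h)

/-- Apply the letters of `a` to the root one at a time. A simple reflection changes a single
coordinate, so a positive root that it turns negative is a multiple of its simple root, hence equal
to it. -/
theorem exists_root_eq_of_nonpos (hδ : IsSymmetrizer cs A δ) (a : List B) {w : W} {s : B}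
    (h0 : 0 ≤ reflRep cs hA w (simpleRoot s))
    (h : reflRep cs hA (cs.wordProd a)⁻¹ (reflRep cs hA w (simpleRoot s)) ≤ 0) :
    ∃ x r y, a = x ++ r :: y ∧
      reflRep cs hA (cs.wordProd x) (simpleRoot r) = reflRep cs hA w (simpleRoot s) := by
  induction a generalizing w with
  | nil =>
    rw [wordProd_nil, inv_one, map_one, LinearEquiv.coe_one, id] at h
    exact absurd (le_antisymm h h0) (reflRep_simpleRoot_ne_zero hA w s)
  | cons q a ih =>
    rcases reflRep_simpleRoot_nonneg_or_nonpos hA hδ (cs.simple q * w) s with h1 | h1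
    · rw [wordProd_cons, mul_inv_rev, inv_simple, reflRep_mul_apply, ← reflRep_mul_apply cs hA _ w]
        at h
      obtain ⟨x, r, y, rfl, hx⟩ := ih h1 h
      refine ⟨q :: x, r, y, rfl, ?_⟩
      rw [wordProd_cons, reflRep_mul_apply, hx, reflRep_mul_apply, ← reflRep_mul_apply,
        cs.simple_mul_simple_self, map_one, LinearEquiv.coe_one, id]
    · refine ⟨[], q, a, rfl, ?_⟩
      rw [wordProd_nil, map_one, LinearEquiv.coe_one, id]
      have h2 : reflRep cs hA w (simpleRoot s) =
          (reflRep cs hA w (simpleRoot s) q) • reflRep cs hA 1 (simpleRoot q) := by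
        funext r
        rw [map_one, LinearEquiv.coe_one, id, Pi.smul_apply, smul_eq_mul]
        by_cases hr : r = q
        · rw [hr, simpleRoot_apply_self, mul_one]
        · have h3 := h1 r
          rw [reflRep_mul_apply, reflRep_simple_apply_of_ne cs hA _ _ hr] at h3
          rw [simpleRoot_apply_of_ne hr, mul_zero]
          exact le_antisymm h3 (h0 r)
      have h3 := (conj_simple_eq_of_root_eq_smul hA hδ h2).2 (h0 q)
      rw [h3, one_smul, map_one, LinearEquiv.coe_one, id] at h2
      exact h2.symm

/-- A form of the exchange property. -/
theorem exists_root_eq_simpleRoot (hδ : IsSymmetrizer cs A δ) {a : List B} {s : B}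
    (h : cs.IsLeftDescent (cs.wordProd a) s) :
    ∃ x r y, a = x ++ r :: y ∧ reflRep cs hA (cs.wordProd x) (simpleRoot r) = simpleRoot s := by
  have := exists_root_eq_of_nonpos hA hδ a (w := 1) (s := s) (by simpa using simpleRoot_nonneg s)
    (by simpa using reflRep_simpleRoot_nonpos hA hδ (cs.isRightDescent_inv_iff.2 h))
  simpa using this

/-- Take the first `s` in a = x s y. The root xα_s has `s`-coordinate 1, which the inverse of the
product preserves when it is computed with `b`. Computed with the reduced word `a`, the image is
-y⁻¹α_s, with nonpositive coordinates. -/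
theorem notMem_of_wordProd_eq (hA : IsCartanMatrix M A) (hδ : IsSymmetrizer cs A δ) {a b : List B} (ha : cs.IsReduced a)
    (hab : cs.wordProd a = cs.wordProd b) {s : B} (hs : s ∉ b) : s ∉ a := by
  intro hsa
  obtain ⟨x, y, rfl, hx⟩ := List.eq_append_cons_of_mem hsa
  have h1 : reflRep cs hA (cs.wordProd (x ++ s :: y))⁻¹
      (reflRep cs hA (cs.wordProd x) (simpleRoot s)) s = 1 := by
    rw [hab, ← wordProd_reverse, reflRep_wordProd_apply_of_notMem cs hA (by simpa using hs),
      reflRep_wordProd_apply_of_notMem cs hA hx, simpleRoot_apply_self]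
  have h2 : cs.IsRightDescent (cs.wordProd y)⁻¹ s → False := by
    intro h
    have h3 := (isRightDescent_inv_iff cs).1 h
    have h4 := IsReduced.isLeftDescent (IsReduced.right ha)
    rw [isLeftDescent_iff_not_isLeftDescent_mul, wordProd_cons,
      cs.simple_mul_simple_cancel_left] at h4
    exact h4 h3
  have h5 := reflRep_simpleRoot_nonneg hA hδ h2 s
  rw [wordProd_append, mul_inv_rev, reflRep_mul_apply, reflRep_inv_apply_apply, wordProd_cons,
    mul_inv_rev, inv_simple, reflRep_mul_apply, reflRep_simple_self, map_neg, Pi.neg_apply] at h1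
  simp only [Pi.zero_apply] at h5
  linarith

/-! ### Words that commute with a simple reflection -/

theorem cartanForm_simpleRoot_nonpos (hA : IsCartanMatrix M A) (hδ : IsSymmetrizer cs A δ) {β : B → ℝ} (h : 0 ≤ β) {s : B}
    (hs : β s = 0) : cartanForm A δ (simpleRoot s) β ≤ 0 := by
  rw [cartanForm_simpleRoot_left]
  refine mul_nonpos_of_nonneg_of_nonpos (hδ.pos s).le ?_
  rw [rowForm, LinearMap.comp_apply, Matrix.mulVecLin_apply, LinearMap.proj_apply, Matrix.mulVec,
    dotProduct]
  refine Finset.sum_nonpos fun r _ => ?_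
  by_cases hr : s = r
  · subst hr; simp [hs]
  · exact mul_nonpos_of_nonpos_of_nonneg (hA.nonpos s r hr) (h r)

theorem reflRep_wordProd_simpleRoot_of_eq_zero {x : List B} {s : B} (h : ∀ q ∈ x, A q s = 0) :
    reflRep cs hA (cs.wordProd x) (simpleRoot s) = simpleRoot s := by
  induction x with
  | nil => simp
  | cons q x ih =>
    rw [List.forall_mem_cons] at h
    rw [wordProd_cons, reflRep_mul_apply, ih h.2, reflRep_simple, h.1, zero_smul, sub_zero]

theorem cartanForm_eq_zero_of_mem_rootSeq (hδ : IsSymmetrizer cs A δ) {x : List B} {s : B}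
    (h : ∀ q ∈ x, A q s = 0) {β : B → ℝ} (hβ : β ∈ rootSeq hA cs x) :
    cartanForm A δ (simpleRoot s) β = 0 := by
  obtain ⟨u, r, y, rfl, rfl⟩ := (mem_rootSeq hA).1 hβ
  have hu := reflRep_wordProd_simpleRoot_of_eq_zero hA (cs := cs) (x := u) (s := s)
    (fun q hq => h q (by simp [hq]))
  rw [← hu, cartanForm_reflRep hA hδ, cartanForm_simpleRoot_simpleRoot, (hA.zero_iff _ _).1
    (h r (by simp)), mul_zero]

theorem eq_zero_of_cartanForm_rootSeq (hδ : IsSymmetrizer cs A δ) {x : List B} {s : B}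
    (h : ∀ β ∈ rootSeq hA cs x, cartanForm A δ (simpleRoot s) β = 0) : ∀ q ∈ x, A q s = 0 := by
  induction x with
  | nil => simp
  | cons q x ih =>
    rw [rootSeq, List.forall_mem_cons] at h
    have hq : A q s = 0 := by
      have := h.1
      rw [cartanForm_simpleRoot_simpleRoot] at this
      exact (hA.zero_iff _ _).1 ((mul_eq_zero.1 this).resolve_left (hδ.pos s).ne')
    rw [List.forall_mem_cons]
    refine ⟨hq, ih fun β hβ => ?_⟩
    rw [← cartanForm_reflRep hA hδ (cs.simple q), reflRep_simple, hq, zero_smul, sub_zero]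
    exact h.2 _ (List.mem_map_of_mem hβ)

/-- Appending `q` to `x` adds -a_{qs} times the positive root xα_q, whose `s`-coordinate is zero, so
every summand pairs nonpositively with α_s. If the total vanishes, each summand does, and
inductively each letter has a_{qs} = 0. -/
theorem cartanForm_displacement (hδ : IsSymmetrizer cs A δ) {x : List B} {s : B}
    (hx : cs.IsReduced x) (hs : s ∉ x) :
    cartanForm A δ (simpleRoot s)
        (reflRep cs hA (cs.wordProd x) (simpleRoot s) - simpleRoot s) ≤ 0 ∧
      (cartanForm A δ (simpleRoot s)
        (reflRep cs hA (cs.wordProd x) (simpleRoot s) - simpleRoot s) = 0 →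
        ∀ q ∈ x, A q s = 0) := by
  induction x using List.reverseRecOn with
  | nil => simp
  | append_singleton x q ih =>
    rw [List.mem_append, not_or, List.mem_singleton] at hs
    obtain ⟨h1, h2⟩ := ih (IsReduced.left hx) hs.1
    set v := reflRep cs hA (cs.wordProd x) with hv
    have e : reflRep cs hA (cs.wordProd (x ++ [q])) (simpleRoot s) - simpleRoot s =
        (v (simpleRoot s) - simpleRoot s) + (-A q s) • v (simpleRoot q) := by
      rw [← List.concat_eq_append, wordProd_concat, reflRep_mul_apply, reflRep_simple, map_sub,
        map_smul]
      module
    have hqs := hA.nonpos q s (Ne.symm hs.2)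
    have h3 : cartanForm A δ (simpleRoot s) (v (simpleRoot q)) ≤ 0 := by
      apply cartanForm_simpleRoot_nonpos hA hδ
      · exact reflRep_simpleRoot_nonneg hA hδ (IsReduced.not_isRightDescent hx)
      · rw [hv, reflRep_wordProd_apply_of_notMem cs hA hs.1, simpleRoot_apply_of_ne hs.2]
    have h4 : (-A q s) * cartanForm A δ (simpleRoot s) (v (simpleRoot q)) ≤ 0 :=
      mul_nonpos_of_nonneg_of_nonpos (by linarith) h3
    rw [e, map_add, map_smul, smul_eq_mul]
    refine ⟨by linarith, fun h0 => ?_⟩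
    have hx0 := h2 (by linarith)
    rw [List.forall_mem_append]
    refine ⟨hx0, fun r hr => ?_⟩
    rw [List.mem_singleton] at hr
    subst hr
    have h5 : (-A r s) * cartanForm A δ (simpleRoot s) (v (simpleRoot r)) = 0 := by linarith
    rcases mul_eq_zero.1 h5 with h6 | h6
    · linarith
    · rw [← reflRep_wordProd_simpleRoot_of_eq_zero hA (cs := cs) hx0, hv, cartanForm_reflRep hA hδ,
        cartanForm_simpleRoot_simpleRoot] at h6
      exact (hA.zero_iff _ _).1 ((mul_eq_zero.1 h6).resolve_left (hδ.pos s).ne')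

/-- The same telescoping sum writes xα_s - α_s as a nonnegative combination of the roots of `x`;
testing against functionals avoids naming the coefficients. -/
theorem displacement_nonneg {x : List B} {s : B} (hs : s ∉ x) (f : (B → ℝ) →ₗ[ℝ] ℝ)
    (hf : ∀ β ∈ rootSeq hA cs x, 0 ≤ f β) :
    0 ≤ f (reflRep cs hA (cs.wordProd x) (simpleRoot s) - simpleRoot s) := by
  induction x using List.reverseRecOn with
  | nil => simp
  | append_singleton x q ih =>
    rw [List.mem_append, not_or, List.mem_singleton] at hs
    rw [rootSeq_append, List.forall_mem_append] at hf
    have h1 := ih hs.1 hf.1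
    have h2 := hf.2 _ (List.mem_map_of_mem (List.mem_cons_self ..))
    have e : reflRep cs hA (cs.wordProd (x ++ [q])) (simpleRoot s) - simpleRoot s =
        (reflRep cs hA (cs.wordProd x) (simpleRoot s) - simpleRoot s) +
          (-A q s) • reflRep cs hA (cs.wordProd x) (simpleRoot q) := by
      rw [← List.concat_eq_append, wordProd_concat, reflRep_mul_apply, reflRep_simple, map_sub,
        map_smul]
      module
    rw [e, map_add, map_smul, smul_eq_mul]
    have := hA.nonpos q s (Ne.symm hs.2)
    exact add_nonneg h1 (mul_nonneg (by linarith) h2)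

end Cambrian

namespace Cambrian

open CoxeterSystem

section

variable {B : Type*} {M : CoxeterMatrix B} {A : Matrix B B ℝ}

/-! ### Sortable words -/

/-- The words that are obtained from sorting words of sortable elements by commutations, with
respect to a partial Coxeter word. -/
inductive IsSortableWord (A : Matrix B B ℝ) : List B → List B → Prop
  | nil : IsSortableWord A [] []
  | skip {s : B} {l a : List B} (hs : s ∉ a) (h : IsSortableWord A l a) :
      IsSortableWord A (s :: l) a
  | take {s : B} {l x y : List B} (hx : ∀ q ∈ x, A q s = 0)
      (h : IsSortableWord A (l ++ [s]) (x ++ y)) : IsSortableWord A (s :: l) (x ++ s :: y)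

theorem IsSortableWord.mem {l a : List B} (h : IsSortableWord A l a) : ∀ q ∈ a, q ∈ l := by
  induction h with
  | nil => simp
  | skip _ _ ih => exact fun q hq => List.mem_cons_of_mem _ (ih q hq)
  | take _ _ ih =>
    intro q hq
    simp only [List.mem_append, List.mem_cons] at hq ih ⊢
    have := ih q
    simp at this
    tauto

/-- If the swapped pair lies within `x` or `y`, induction applies. If it contains the marked `s`,
the neighbour of `s` enters or leaves `x`. -/
theorem IsSortableWord.swap (hA : IsCartanMatrix M A) {l a : List B}
    (h : IsSortableWord A l a) : ∀ {u v : List B} {p q : B}, a = u ++ p :: q :: v → A p q = 0 →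
    IsSortableWord A l (u ++ q :: p :: v) := by
  induction h with
  | nil => intro u v p q h; simp at h
  | skip hs _ ih =>
    intro u v p q h hpq
    refine .skip ?_ (ih h hpq)
    rw [h] at hs
    simp only [List.mem_append, List.mem_cons] at hs ⊢
    tauto
  | @take s l x y hx h ih =>
    intro u v p q he hpq
    rcases List.append_eq_append_iff.1 he with ⟨z, rfl, hz⟩ | ⟨z, rfl, hz⟩
    · rcases z with _ | ⟨z0, z⟩
      · simp only [List.nil_append, List.cons.injEq] at hz
        obtain ⟨rfl, rfl⟩ := hz
        have := IsSortableWord.take (s := s) (l := l) (x := x ++ [q]) (y := v) (A := A) (by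
          intro r hr
          rcases List.mem_append.1 hr with hr | hr
          · exact hx r hr
          · rw [List.mem_singleton.1 hr]; exact (hA.zero_iff _ _).1 hpq) (by simpa using h)
        simpa using this
      · simp only [List.cons_append, List.cons.injEq] at hz
        obtain ⟨rfl, rfl⟩ := hz
        have := IsSortableWord.take hx (y := z ++ q :: p :: v)
          (by rw [← List.append_assoc]; exact ih (by simp) hpq)
        simpa using this
    · rcases z with _ | ⟨z0, z⟩
      · simp only [List.nil_append, List.cons.injEq] at hz
        obtain ⟨rfl, rfl⟩ := hz
        have := IsSortableWord.take (s := p) (l := l) (x := u ++ [q]) (y := v) (A := A) (by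
          intro r hr
          rcases List.mem_append.1 hr with hr | hr
          · exact hx r (by simpa using hr)
          · rw [List.mem_singleton.1 hr]; exact (hA.zero_iff _ _).1 hpq) (by simpa using h)
        simpa using this
      · simp only [List.cons_append, List.cons.injEq] at hz
        obtain ⟨rfl, hz⟩ := hz
        rcases z with _ | ⟨z1, z⟩
        · simp only [List.nil_append, List.cons.injEq] at hz
          obtain ⟨rfl, rfl⟩ := hz
          refine IsSortableWord.take (fun r hr => hx r (by simp [hr])) ?_
          simpa using h
        · simp only [List.cons_append, List.cons.injEq] at hz
          obtain ⟨rfl, rfl⟩ := hz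
          have := IsSortableWord.take (s := s) (l := l) (x := u ++ q :: p :: z) (y := y) (A := A)
            (fun r hr => hx r (by
              simp only [List.mem_append, List.mem_cons] at hr ⊢; tauto))
            (by simpa using ih (u := u) (v := z ++ y) (by simp) hpq)
          simpa using this

end

section

variable {B : Type*} [Fintype B] [DecidableEq B] {A : Matrix B B ℝ} {δ : B → ℝ}

/-! ### Euler forms of partial Coxeter words -/

theorem eulerForm_simpleRoot_simpleRoot (l : List B) (r q : B) :
    eulerForm A δ l (simpleRoot r) (simpleRoot q) =
      δ r * if l.idxOf q < l.idxOf r then A r q else if r = q then 1 else 0 := by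
  rw [eulerForm, simpleRoot, simpleRoot, Matrix.toBilin'_single, Matrix.of_apply]

theorem bilinForm_congr_of_support {F G : LinearMap.BilinForm ℝ (B → ℝ)} {p : B → Prop}
    (h : ∀ r q, p r → p q → F (simpleRoot r) (simpleRoot q) = G (simpleRoot r) (simpleRoot q))
    {x y : B → ℝ} (hx : ∀ r, ¬ p r → x r = 0) (hy : ∀ r, ¬ p r → y r = 0) : F x y = G x y := by
  have e (v : B → ℝ) : v = ∑ r, v r • simpleRoot r := by
    funext q
    simp [simpleRoot, Pi.single_apply]
  rw [e x, e y]
  simp only [map_sum, map_smul, LinearMap.sum_apply, LinearMap.smul_apply]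
  refine Finset.sum_congr rfl fun r _ => ?_
  by_cases hr : p r
  · refine congrArg _ (Finset.sum_congr rfl fun q _ => ?_)
    by_cases hq : p q
    · rw [h _ _ hq hr]
    · rw [hx _ hq, zero_smul, zero_smul]
  · rw [hy _ hr, zero_smul, zero_smul]

theorem eulerForm_cons_of_apply_eq_zero {s : B} {l : List B} {x y : B → ℝ} (hx : x s = 0)
    (hy : y s = 0) : eulerForm A δ (s :: l) x y = eulerForm A δ l x y := by
  refine bilinForm_congr_of_support (p := fun r => r ≠ s) (fun r q hr hq => ?_)
    (fun r hr => by rw [not_not.1 hr, hx]) (fun r hr => by rw [not_not.1 hr, hy])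
  rw [eulerForm_simpleRoot_simpleRoot, eulerForm_simpleRoot_simpleRoot,
    List.idxOf_cons_ne _ (Ne.symm hr), List.idxOf_cons_ne _ (Ne.symm hq)]
  simp

theorem omegaForm_cons_of_apply_eq_zero {s : B} {l : List B} {x y : B → ℝ} (hx : x s = 0)
    (hy : y s = 0) : omegaForm A δ (s :: l) x y = omegaForm A δ l x y := by
  rw [omegaForm, omegaForm, eulerForm_cons_of_apply_eq_zero hx hy,
    eulerForm_cons_of_apply_eq_zero hy hx]

theorem omegaForm_neg (l : List B) (x y : B → ℝ) :
    omegaForm A δ l x y = -omegaForm A δ l y x := by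
  rw [omegaForm, omegaForm, neg_sub]

end

variable {B W : Type*} [Fintype B] [DecidableEq B] [Group W] {M : CoxeterMatrix B}
  {cs : CoxeterSystem M W} {A : Matrix B B ℝ} (hA : IsCartanMatrix M A) {δ : B → ℝ}

/-- The support conditions matter: `List.idxOf` puts absent letters after `s` in both words, and for
them the identity fails in general. -/
theorem eulerForm_rotate (hδ : IsSymmetrizer cs A δ) {s : B} {l : List B} (hl : (s :: l).Nodup)
    {x y : B → ℝ} (hx : ∀ r ∉ s :: l, x r = 0) (hy : ∀ r ∉ s :: l, y r = 0) :
    eulerForm A δ (l ++ [s]) (reflRep cs hA (cs.simple s) x) (reflRep cs hA (cs.simple s) y) =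
      eulerForm A δ (s :: l) x y := by
  have hsl : s ∉ l := (List.nodup_cons.1 hl).1
  have hs : (l ++ [s]).idxOf s = l.length := by
    rw [List.idxOf_append_of_notMem hsl]; simp
  have hlt {r : B} (hr : r ∈ l) : (l ++ [s]).idxOf r = l.idxOf r ∧ l.idxOf r < l.length :=
    ⟨List.idxOf_append_of_mem hr, List.idxOf_lt_length_iff.2 hr⟩
  have hne {r : B} (hr : r ∈ l) : r ≠ s := by rintro rfl; exact hsl hr
  let G : LinearMap.BilinForm ℝ (B → ℝ) := (eulerForm A δ (l ++ [s])).compl₁₂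
    (reflRep cs hA (cs.simple s)).toLinearMap (reflRep cs hA (cs.simple s)).toLinearMap
  change G x y = _
  refine bilinForm_congr_of_support (p := fun r => r ∈ s :: l) (fun r q hr hq => ?_) hx hy
  simp only [G, LinearMap.compl₁₂_apply, LinearEquiv.coe_coe, reflRep_simple, map_sub, map_smul,
    LinearMap.sub_apply, LinearMap.smul_apply, eulerForm_simpleRoot_simpleRoot, smul_eq_mul, hs]
  rw [List.mem_cons] at hr hq
  rcases hr with rfl | hr <;> rcases hq with rfl | hq
  · simp only [hs, hA.diag, lt_irrefl, if_false, if_true]; ring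
  · have h1 := hlt hq
    simp only [hs, hA.diag, h1.1, h1.2, lt_irrefl, if_false, if_true, List.idxOf_cons_self,
      not_lt_zero, (hne hq).symm]
    ring
  · have h1 := hlt hr
    simp only [hs, hA.diag, h1.1, h1.2.not_gt, lt_irrefl, if_false, if_true, List.idxOf_cons_self,
      hne hr, List.idxOf_cons_ne _ (hne hr).symm, Nat.succ_pos]
    linarith [hδ.symm q r]
  · have h1 := hlt hr
    have h2 := hlt hq
    simp only [h1.1, h2.1, h1.2.not_gt, h2.2, lt_irrefl, if_false, if_true,
      hne hr, List.idxOf_cons_ne _ (hne hr).symm, List.idxOf_cons_ne _ (hne hq).symm,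
      Nat.succ_lt_succ_iff]
    linarith [hδ.symm s r]

theorem omegaForm_rotate (hδ : IsSymmetrizer cs A δ) {s : B} {l : List B} (hl : (s :: l).Nodup)
    {x y : B → ℝ} (hx : ∀ r ∉ s :: l, x r = 0) (hy : ∀ r ∉ s :: l, y r = 0) :
    omegaForm A δ (s :: l) (reflRep cs hA (cs.simple s) x) (reflRep cs hA (cs.simple s) y) =
      omegaForm A δ (l ++ [s]) x y := by
  have h (v : B → ℝ) : reflRep cs hA (cs.simple s) (reflRep cs hA (cs.simple s) v) = v := by
    rw [← reflRep_mul_apply, cs.simple_mul_simple_self, map_one, LinearEquiv.coe_one, id]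
  have h' {v : B → ℝ} (hv : ∀ r ∉ s :: l, v r = 0) :
      ∀ r ∉ s :: l, reflRep cs hA (cs.simple s) v r = 0 := by
    intro r hr
    rw [reflRep_simple_apply_of_ne cs hA _ _ (List.ne_of_not_mem_cons hr), hv r hr]
  rw [omegaForm, omegaForm, ← eulerForm_rotate hA hδ hl (h' hx) (h' hy),
    ← eulerForm_rotate hA hδ hl (h' hy) (h' hx), h, h]

/-- Since `s` is first and absent letters count as later, no support condition on β is needed. -/
theorem omegaForm_simpleRoot_left (hA : IsCartanMatrix M A) (hδ : IsSymmetrizer cs A δ)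
    {s : B} {l : List B} (β : B → ℝ) :
    omegaForm A δ (s :: l) (simpleRoot s) β =
      2 * δ s * β s - cartanForm A δ (simpleRoot s) β := by
  have h : eulerForm A δ (s :: l) (simpleRoot s) - (eulerForm A δ (s :: l)).flip (simpleRoot s) =
      (2 * δ s) • LinearMap.proj s - cartanForm A δ (simpleRoot s) := by
    refine LinearMap.pi_ext' fun r => LinearMap.ext_ring ?_
    change eulerForm A δ (s :: l) (simpleRoot s) (simpleRoot r) -
      eulerForm A δ (s :: l) (simpleRoot r) (simpleRoot s) =
      (2 * δ s) * (simpleRoot r s) - cartanForm A δ (simpleRoot s) (simpleRoot r)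
    rw [eulerForm_simpleRoot_simpleRoot, eulerForm_simpleRoot_simpleRoot,
      cartanForm_simpleRoot_simpleRoot]
    by_cases hr : s = r
    · subst hr
      simp only [hA.diag, lt_irrefl, if_false, if_true, simpleRoot_apply_self]; ring
    · simp only [List.idxOf_cons_self, not_lt_zero, if_false, hr, List.idxOf_cons_ne _ hr,
        Nat.succ_pos, if_true, simpleRoot_apply_of_ne hr]
      linarith [hδ.symm s r]
  exact LinearMap.congr_fun h β

theorem omegaForm_simpleRoot_nonneg (hA : IsCartanMatrix M A) (hδ : IsSymmetrizer cs A δ)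
    {s : B} {l : List B} {β : B → ℝ} (hβ : 0 ≤ β) :
    0 ≤ omegaForm A δ (s :: l) (simpleRoot s) β := by
  rw [omegaForm_simpleRoot_left hA hδ]
  have h1 := cartanForm_simpleRoot_nonpos hA hδ (β := β - β s • simpleRoot s) (s := s)
    (by
      intro r
      by_cases hr : r = s
      · subst hr; simp [simpleRoot_apply_self]
      · simpa [simpleRoot_apply_of_ne hr] using hβ r)
    (by simp [simpleRoot_apply_self])
  rw [map_sub, map_smul, cartanForm_simpleRoot_simpleRoot, hA.diag, smul_eq_mul] at h1
  linarith

/-- The value is δ(s)(β_s + (sβ)_s). If it vanishes, both coordinates do, and their difference is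
K(α_s, β)/δ(s). -/
theorem omegaForm_simpleRoot_pos (hδ : IsSymmetrizer cs A δ)
    {s : B} {l : List B} {β : B → ℝ} (hβ : 0 ≤ β) (hsβ : 0 ≤ reflRep cs hA (cs.simple s) β)
    (h : cartanForm A δ (simpleRoot s) β ≠ 0) :
    0 < omegaForm A δ (s :: l) (simpleRoot s) β := by
  refine (omegaForm_simpleRoot_nonneg hA hδ hβ).lt_of_ne fun h0 => h ?_
  have hs := hδ.pos s
  have h1 := hsβ s
  have h2 := hβ s
  rw [omegaForm_simpleRoot_left hA hδ] at h0
  rw [cartanForm_simpleRoot_left] at h0 ⊢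
  rw [reflRep_simple_apply] at h1
  simp only [Pi.zero_apply, Pi.sub_apply, Pi.smul_apply, simpleRoot_apply_self, smul_eq_mul,
    mul_one] at h1 h2
  have h3 : δ s * (β s + (β s - rowForm A s β)) = 0 := by linarith
  have h4 := (mul_eq_zero.1 h3).resolve_left hs.ne'
  have h5 : rowForm A s β = 0 := by linarith
  rw [h5, mul_zero]

/-! ### Aligned words -/

/-- The condition that the roots of the word `a` are in the order prescribed by the
skew-symmetric form of the (partial) Coxeter word `l`. -/
def IsAligned (δ : B → ℝ) (cs : CoxeterSystem M W) (l a : List B) : Prop :=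
  (rootSeq hA cs a).Pairwise fun β β' => 0 ≤ omegaForm A δ l β β' ∧
    (cartanForm A δ β β' ≠ 0 → 0 < omegaForm A δ l β β')

theorem isAligned_cons_of_notMem {s : B} {l a : List B} (hs : s ∉ a) :
    IsAligned hA δ cs (s :: l) a ↔ IsAligned hA δ cs l a := by
  refine List.Pairwise.iff_of_mem fun {β β'} hβ hβ' => ?_
  rw [omegaForm_cons_of_apply_eq_zero (rootSeq_apply_of_notMem hA hs hβ)
    (rootSeq_apply_of_notMem hA hs hβ')]

theorem wordProd_append_cons_of_eq_zero (hA : IsCartanMatrix M A) (hδ : IsSymmetrizer cs A δ)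
    {x : List B} {s : B} (hx : ∀ q ∈ x, A q s = 0) (y : List B) :
    cs.wordProd (x ++ s :: y) = cs.wordProd (s :: (x ++ y)) := by
  induction x with
  | nil => rfl
  | cons q x ih =>
    rw [List.forall_mem_cons] at hx
    rw [List.cons_append, wordProd_cons, ih hx.2]
    simp only [wordProd_cons, List.cons_append]
    rw [← mul_assoc, ← mul_assoc, (commute_simple_of_eq_zero hA hδ hx.1).eq]

theorem isReduced_cons_append (hA : IsCartanMatrix M A) (hδ : IsSymmetrizer cs A δ)
    {x y : List B} {s : B} (hx : ∀ q ∈ x, A q s = 0) :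
    cs.IsReduced (s :: (x ++ y)) ↔ cs.IsReduced (x ++ s :: y) := by
  unfold CoxeterSystem.IsReduced
  rw [wordProd_append_cons_of_eq_zero hA hδ hx]
  simp [add_assoc]

theorem rootSeq_append_cons (hδ : IsSymmetrizer cs A δ) {x : List B} {s : B}
    (hx : ∀ q ∈ x, A q s = 0) (y : List B) :
    rootSeq hA cs (x ++ s :: y) =
      (rootSeq hA cs x).map (reflRep cs hA (cs.simple s)) ++ simpleRoot s ::
        ((rootSeq hA cs y).map (reflRep cs hA (cs.wordProd x))).map
          (reflRep cs hA (cs.simple s)) := by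
  have h1 : (rootSeq hA cs x).map (reflRep cs hA (cs.simple s)) = rootSeq hA cs x := by
    conv_rhs => rw [← List.map_id (rootSeq hA cs x)]
    refine List.map_congr_left fun β hβ => ?_
    have := cartanForm_eq_zero_of_mem_rootSeq hA hδ hx hβ
    rw [cartanForm_simpleRoot_left] at this
    rw [reflRep_simple_apply, (mul_eq_zero.1 this).resolve_left (hδ.pos s).ne', zero_smul,
      sub_zero, id]
  rw [h1, rootSeq_append, rootSeq, List.map_cons, reflRep_wordProd_simpleRoot_of_eq_zero hA hx]
  simp only [List.map_map]
  congr 3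
  funext v
  have h2 : cs.wordProd x * cs.simple s = cs.simple s * cs.wordProd x := by
    simpa [wordProd_append, wordProd_cons] using wordProd_append_cons_of_eq_zero hA hδ hx []
  rw [Function.comp, Function.comp, ← reflRep_mul_apply, ← reflRep_mul_apply, h2]

/-- The roots of x s y are α_s and the `s`-images of the roots of x y. Pairs of images are handled
by rotating the form. Roots of `x` are orthogonal to α_s with zero `s`-coordinate, so ω vanishes
there; α_s against later roots is automatic. -/
theorem isAligned_append_cons (hδ : IsSymmetrizer cs A δ) {s : B} {l x y : List B}
    (hl : (s :: l).Nodup) (hx : ∀ q ∈ x, A q s = 0) (hred : cs.IsReduced (x ++ s :: y))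
    (hmem : ∀ q ∈ x ++ y, q ∈ s :: l) :
    IsAligned hA δ cs (s :: l) (x ++ s :: y) ↔ IsAligned hA δ cs (l ++ [s]) (x ++ y) := by
  have hred' := (isReduced_cons_append hA hδ hx).2 hred
  have hsx : s ∉ x := fun h => by have := hx s h; rw [hA.diag] at this; norm_num at this
  have hroots := rootSeq_append_cons hA hδ hx y
  have key : ((rootSeq hA cs (x ++ y)).map (reflRep cs hA (cs.simple s))).Pairwise
      (fun β β' => 0 ≤ omegaForm A δ (s :: l) β β' ∧
        (cartanForm A δ β β' ≠ 0 → 0 < omegaForm A δ (s :: l) β β')) ↔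
      IsAligned hA δ cs (l ++ [s]) (x ++ y) := by
    rw [List.pairwise_map]
    refine List.Pairwise.iff_of_mem fun {β β'} hβ hβ' => ?_
    rw [omegaForm_rotate hA hδ hl, cartanForm_reflRep hA hδ]
    · exact fun r hr => rootSeq_apply_of_notMem hA (fun h => hr (hmem r h)) hβ
    · exact fun r hr => rootSeq_apply_of_notMem hA (fun h => hr (hmem r h)) hβ'
  rw [← key, IsAligned, hroots, rootSeq_append, List.map_append, List.pairwise_append,
    List.pairwise_append, List.pairwise_cons]
  constructor
  · rintro ⟨h1, h2, h3⟩
    exact ⟨h1, h2.2, fun β hβ β' hβ' => h3 β hβ β' (List.mem_cons_of_mem _ hβ')⟩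
  · rintro ⟨h1, h2, h3⟩
    refine ⟨h1, ⟨fun β hβ => ?_, h2⟩, fun β hβ β' hβ' => ?_⟩
    · obtain ⟨γ, hγ, rfl⟩ := List.mem_map.1 hβ
      have hγ' : γ ∈ rootSeq hA cs (x ++ y) := by
        rw [rootSeq_append]; exact List.mem_append_right _ hγ
      have h4 : 0 ≤ γ := rootSeq_nonneg hA hδ (IsReduced.right (x := [s]) hred') hγ'
      have h5 : 0 ≤ reflRep cs hA (cs.simple s) γ := by
        refine rootSeq_nonneg hA hδ hred' ?_
        rw [rootSeq]
        exact List.mem_cons_of_mem _ (List.mem_map_of_mem hγ')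
      refine ⟨omegaForm_simpleRoot_nonneg hA hδ h5, omegaForm_simpleRoot_pos hA hδ h5 ?_⟩
      rwa [← reflRep_mul_apply, cs.simple_mul_simple_self, map_one, LinearEquiv.coe_one, id]
    · rcases List.mem_cons.1 hβ' with rfl | hβ'
      · obtain ⟨γ, hγ, rfl⟩ := List.mem_map.1 hβ
        have h4 : cartanForm A δ (simpleRoot s) (reflRep cs hA (cs.simple s) γ) = 0 := by
          rw [← neg_neg (simpleRoot s), ← reflRep_simple_self cs hA, map_neg, LinearMap.neg_apply,
            cartanForm_reflRep hA hδ, cartanForm_eq_zero_of_mem_rootSeq hA hδ hx hγ, neg_zero]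
        have h5 : reflRep cs hA (cs.simple s) γ s = 0 := by
          have h6 := cartanForm_eq_zero_of_mem_rootSeq hA hδ hx hγ
          rw [cartanForm_simpleRoot_left] at h6
          rw [reflRep_simple_apply, (mul_eq_zero.1 h6).resolve_left (hδ.pos s).ne', zero_smul,
            sub_zero, rootSeq_apply_of_notMem hA hsx hγ]
        rw [omegaForm_neg, omegaForm_simpleRoot_left hA hδ, h4, h5, cartanForm_comm hδ, h4]
        simp
      · exact h3 β hβ β' hβ'

theorem IsSortableWord.isAligned (hδ : IsSymmetrizer cs A δ) {l a : List B}
    (h : IsSortableWord A l a) (hl : l.Nodup) (ha : cs.IsReduced a) : IsAligned hA δ cs l a := by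
  induction h with
  | nil => exact List.Pairwise.nil
  | skip hs _ ih => exact (isAligned_cons_of_notMem hA hs).2 (ih (List.nodup_cons.1 hl).2 ha)
  | @take s l x y hx h ih =>
    rw [isAligned_append_cons hA hδ hl hx ha]
    · exact ih (by rw [List.nodup_append_comm]; exact hl)
        (IsReduced.right (x := [s]) ((isReduced_cons_append hA hδ hx).2 ha))
    · intro q hq
      have := h.mem q hq
      rw [List.mem_append, List.mem_singleton, or_comm] at this
      exact List.mem_cons.2 this

/-- For a root β preceding α_s, alignment and the initial position of `s` give opposite inequalities
for ω(β, α_s). Strictness then forces orthogonality. -/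
theorem IsAligned.prefix_eq_zero (hδ : IsSymmetrizer cs A δ) {s : B} {l x y : List B} {r : B}
    (h : IsAligned hA δ cs (s :: l) (x ++ r :: y)) (ha : cs.IsReduced (x ++ r :: y))
    (hr : reflRep cs hA (cs.wordProd x) (simpleRoot r) = simpleRoot s) :
    r = s ∧ ∀ q ∈ x, A q s = 0 := by
  have h0 : ∀ q ∈ x, A q s = 0 := by
    refine eq_zero_of_cartanForm_rootSeq hA hδ fun β hβ => ?_
    rw [IsAligned, rootSeq_append, List.pairwise_append] at h
    have h1 := h.2.2 β hβ (simpleRoot s) (by rw [rootSeq, List.map_cons, hr]; exact .head _)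
    have h2 := omegaForm_simpleRoot_nonneg hA hδ (s := s) (l := l)
      (rootSeq_nonneg hA hδ (IsReduced.left ha) hβ)
    rw [omegaForm_neg] at h2
    by_contra h3
    rw [cartanForm_comm hδ] at h3
    linarith [h1.2 h3]
  refine ⟨?_, h0⟩
  rw [← reflRep_wordProd_simpleRoot_of_eq_zero hA (cs := cs) h0] at hr
  exact simpleRoot_injective ((reflRep cs hA (cs.wordProd x)).injective hr)

theorem IsAligned.isLeftDescent_of_mem (hδ : IsSymmetrizer cs A δ) {s : B} {l a : List B}
    (h : IsAligned hA δ cs (s :: l) a) (ha : cs.IsReduced a) (hs : s ∈ a) :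
    cs.IsLeftDescent (cs.wordProd a) s := by
  obtain ⟨x, y, rfl, hx⟩ := List.eq_append_cons_of_mem hs
  have h0 : ∀ q ∈ x, A q s = 0 := by
    set γ := reflRep cs hA (cs.wordProd x) (simpleRoot s) with hγ
    have hxr := IsReduced.left ha
    obtain ⟨h1, h2⟩ := cartanForm_displacement hA hδ hxr hx
    refine h2 (le_antisymm h1 ?_)
    -- The functional is ω(·, γ), nonnegative on the roots of `x` by alignment.
    have h3 := displacement_nonneg hA (cs := cs) hx
      ((eulerForm A δ (s :: l)).flip γ - eulerForm A δ (s :: l) γ) (fun β hβ => by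
        rw [IsAligned, rootSeq_append, List.pairwise_append] at h
        exact (h.2.2 β hβ γ (by rw [rootSeq, List.map_cons]; exact .head _)).1)
    change 0 ≤ omegaForm A δ (s :: l) (γ - simpleRoot s) γ at h3
    have h4 : omegaForm A δ (s :: l) (γ - simpleRoot s) γ =
        -omegaForm A δ (s :: l) (simpleRoot s) (γ - simpleRoot s) := by
      simp only [omegaForm, map_sub, LinearMap.sub_apply]; ring
    have h5 : (γ - simpleRoot s) s = 0 := by
      rw [Pi.sub_apply, hγ, reflRep_wordProd_apply_of_notMem cs hA hx, sub_self]
    rw [h4, omegaForm_simpleRoot_left hA hδ, h5] at h3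
    linarith
  rw [wordProd_append_cons_of_eq_zero hA hδ h0]
  exact IsReduced.isLeftDescent ((isReduced_cons_append hA hδ h0).2 ha)

theorem IsAligned.isSortableWord (hδ : IsSymmetrizer cs A δ) {l a : List B}
    (h : IsAligned hA δ cs l a) (hl : l.Nodup) (ha : cs.IsReduced a) (hmem : ∀ q ∈ a, q ∈ l) :
    IsSortableWord A l a := by
  -- Skipping a letter shortens `l`; taking one rotates `l` and shortens `a`.
  induction hn : l.length + a.length generalizing l a with
  | zero =>
    obtain ⟨rfl, rfl⟩ : l = [] ∧ a = [] := by
      constructor <;> apply List.eq_nil_of_length_eq_zero <;> omega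
    exact .nil
  | succ n ih =>
    rcases l with _ | ⟨s, l⟩
    · obtain rfl : a = [] := List.eq_nil_iff_forall_not_mem.2 fun q hq => by simpa using hmem q hq
      exact .nil
    by_cases hs : s ∈ a
    · obtain ⟨x, r, y, rfl, hr⟩ := exists_root_eq_simpleRoot hA hδ (h.isLeftDescent_of_mem hA hδ ha hs)
      obtain ⟨rfl, hx⟩ := h.prefix_eq_zero hA hδ ha hr
      have hmem' : ∀ q ∈ x ++ y, q ∈ r :: l := fun q hq => hmem q (by
        simp only [List.mem_append, List.mem_cons] at hq ⊢; tauto)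
      rw [isAligned_append_cons hA hδ hl hx ha hmem'] at h
      refine .take hx (ih h (by rw [List.nodup_append_comm]; exact hl)
        (IsReduced.right (x := [r]) ((isReduced_cons_append hA hδ hx).2 ha)) ?_ ?_)
      · intro q hq
        have := hmem' q hq
        rw [List.mem_cons, or_comm] at this
        rwa [List.mem_append, List.mem_singleton]
      · simp at hn ⊢; omega
    · rw [isAligned_cons_of_notMem hA hs] at h
      refine .skip hs (ih h (List.nodup_cons.1 hl).2 ha (fun q hq => ?_) ?_)
      · exact (List.mem_cons.1 (hmem q hq)).resolve_left (fun h => hs (h ▸ hq))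
      · simp at hn ⊢; omega

end Cambrian

namespace Cambrian

open CoxeterSystem

section

/-! ### Positions in periodic words -/

variable {B : Type*}

theorem lex_map_iff {f : ℕ → ℕ} (hf : StrictMono f) {P Q : List ℕ} :
    List.Lex (· < ·) (P.map f) (Q.map f) ↔ List.Lex (· < ·) P Q := by
  induction P generalizing Q with
  | nil => cases Q <;> simp
  | cons p P ih =>
    cases Q with
    | nil => simp
    | cons q Q => simp [List.cons_lex_cons_iff, ih, hf.lt_iff_lt, hf.injective.eq_iff]

theorem eq_or_lex_map_iff {f : ℕ → ℕ} (hf : StrictMono f) {P Q : List ℕ} :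
    (P.map f = Q.map f ∨ List.Lex (· < ·) (P.map f) (Q.map f)) ↔
      (P = Q ∨ List.Lex (· < ·) P Q) := by
  rw [lex_map_iff hf, (List.map_injective_iff.2 hf.injective).eq_iff]

theorem getElem?_cons_succ_mod (s : B) (l : List B) (p : ℕ) :
    (s :: l)[(p + 1) % (s :: l).length]? = (l ++ [s])[p % (l ++ [s]).length]? := by
  simp only [List.length_cons, List.length_append, List.length_nil, zero_add]
  have h := Nat.mod_lt p (Nat.succ_pos l.length)
  have h1 : (p + 1) % (l.length + 1) = (p % (l.length + 1) + 1) % (l.length + 1) := by simp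
  rw [h1]
  rcases Nat.lt_or_ge (p % (l.length + 1)) l.length with h2 | h2
  · rw [Nat.mod_eq_of_lt (by omega), List.getElem?_cons_succ, List.getElem?_append_left h2]
  · have h3 : p % (l.length + 1) = l.length := by simp only [Nat.succ_eq_add_one] at h; omega
    simp [h3]

theorem spells_cons_map_succ {s : B} {l : List B} {P : List ℕ} {a : List B} :
    Spells (s :: l) (P.map (· + 1)) a ↔ Spells (l ++ [s]) P a := by
  simp only [Spells, List.forall₂_map_left_iff, getElem?_cons_succ_mod]

/-- The position in `(s l)^∞` that corresponds to the position `p` in `l^∞`, if `n` is the length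
of `l`. -/
def skipPosition (n p : ℕ) : ℕ := p / n * (n + 1) + p % n + 1

theorem skipPosition_strictMono (n : ℕ) : StrictMono (skipPosition n) := by
  rcases Nat.eq_zero_or_pos n with rfl | hn
  · intro p q h; simpa [skipPosition] using h
  · intro p q h
    have hp := Nat.div_add_mod p n
    have hq := Nat.div_add_mod q n
    have hp' := Nat.mod_lt p hn
    have h1 : p / n ≤ q / n := Nat.div_le_div_right h.le
    unfold skipPosition
    rcases h1.eq_or_lt with h2 | h2
    · rw [h2] at hp ⊢; omega
    · nlinarith

theorem skipPosition_mod {n : ℕ} (hn : 0 < n) (p : ℕ) : skipPosition n p % (n + 1) = p % n + 1 := by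
  have h := Nat.mod_lt p hn
  rw [skipPosition, add_assoc, Nat.mul_add_mod_self_right, Nat.mod_eq_of_lt (by omega)]

theorem skipPosition_add {n : ℕ} (hn : 0 < n) (p : ℕ) :
    skipPosition n (p + n) = skipPosition n p + (n + 1) := by
  rw [skipPosition, skipPosition, Nat.add_div_right _ hn, Nat.add_mod_right]; ring

theorem Spells.skip {s : B} {l : List B} {P : List ℕ} {a : List B} (h : Spells l P a) :
    Spells (s :: l) (P.map (skipPosition l.length)) a := by
  rw [Spells, List.forall₂_map_left_iff]
  refine h.imp fun p b hb => ?_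
  have hn : 0 < l.length := by
    rcases l with _ | _ <;> simp at hb ⊢
  rw [List.length_cons, skipPosition_mod hn, List.getElem?_cons_succ, hb]

theorem Spells.exists_of_notMem {s : B} {l : List B} {Q : List ℕ} {b : List B}
    (h : Spells (s :: l) Q b) (hs : s ∉ b) :
    ∃ P : List ℕ, Q = P.map (skipPosition l.length) ∧ Spells l P b := by
  induction h with
  | nil => exact ⟨[], rfl, .nil⟩
  | @cons q r Q b hq _ ih =>
    rw [List.mem_cons, not_or] at hs
    obtain ⟨P, rfl, hP⟩ := ih hs.2
    rw [List.length_cons] at hq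
    have hlt := Nat.mod_lt q (Nat.succ_pos l.length)
    have hdiv := Nat.div_add_mod q (l.length + 1)
    rcases hm : q % (l.length + 1) with _ | m
    · rw [hm] at hq; simp at hq; exact absurd hq hs.1
    rw [hm, List.getElem?_cons_succ] at hq
    simp only [Nat.succ_eq_add_one] at hlt
    have hml : m < l.length := by omega
    have e1 : (q / (l.length + 1) * l.length + m) / l.length = q / (l.length + 1) := by
      rw [mul_comm, Nat.mul_add_div (by omega), Nat.div_eq_of_lt hml, add_zero]
    have e2 : (q / (l.length + 1) * l.length + m) % l.length = m := by
      rw [Nat.mul_add_mod_self_right, Nat.mod_eq_of_lt hml]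
    refine ⟨(q / (l.length + 1) * l.length + m) :: P, ?_, .cons ?_ hP⟩
    · rw [List.map_cons, skipPosition, e1, e2]
      congr 1
      rw [mul_comm]
      omega
    · rw [e2, hq]

theorem Spells.notMem {s : B} {l : List B} (hs : s ∉ l) {Q : List ℕ} {b : List B}
    (h : Spells (s :: l) Q b) (hQ : ∀ q ∈ Q, ¬ (l.length + 1) ∣ q) : s ∉ b := by
  induction h with
  | nil => simp
  | @cons q r Q b hq _ ih =>
    rw [List.forall_mem_cons] at hQ
    rw [List.mem_cons, not_or]
    refine ⟨?_, ih hQ.2⟩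
    rintro rfl
    rw [List.length_cons] at hq
    rcases hm : q % (l.length + 1) with _ | m
    · exact hQ.1 (Nat.dvd_of_mod_eq_zero hm)
    · rw [hm, List.getElem?_cons_succ] at hq
      exact hs (List.mem_of_getElem? hq)

theorem Spells.eq_of_eq {l : List B} {P : List ℕ} {a b : List B} (ha : Spells l P a)
    (hb : Spells l P b) : a = b := by
  induction ha generalizing b with
  | nil => cases hb; rfl
  | cons h _ ih =>
    cases hb with
    | cons h' hb' => rw [ih hb', Option.some.inj (h.symm.trans h')]

/-- A set of positions in a periodic word of period `n` is closed under moving back by `n`. -/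
def IsPeriodClosed (n : ℕ) (P : List ℕ) : Prop := ∀ p, p + n ∈ P → p ∈ P

/-- Without repetitions in `l`, a letter determines its residue modulo the period, so nested blocks
amount to closure under one backward shift. -/
theorem antitone_block_iff {l : List B} (hl : l.Nodup) {P : List ℕ} :
    Antitone (block l P) ↔ IsPeriodClosed l.length P := by
  rcases Nat.eq_zero_or_pos l.length with hn | hn
  · rw [List.length_eq_zero_iff] at hn
    subst hn
    refine ⟨fun _ p hp => hp, fun _ => antitone_nat_of_succ_le fun k b hb => ?_⟩
    obtain ⟨p, _, _, h⟩ := hb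
    simp at h
  constructor
  · intro h p hp
    have hlt := Nat.mod_lt p hn
    have hb : l[p % l.length] ∈ block l P (p / l.length + 1) :=
      ⟨p + l.length, hp, Nat.add_div_right _ hn, by simp⟩
    obtain ⟨q, hq, hqd, hqm⟩ := h (Nat.le_succ (p / l.length)) hb
    have hq' := Nat.mod_lt q hn
    rw [List.getElem?_eq_getElem hq', Option.some.injEq, hl.getElem_inj_iff] at hqm
    rwa [← Nat.div_add_mod p l.length, ← hqd, ← hqm, Nat.div_add_mod]
  · intro h
    refine antitone_nat_of_succ_le fun k b hb => ?_
    obtain ⟨p, hp, hpd, hpm⟩ := hb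
    have hle : l.length ≤ p := by
      by_contra hlt
      rw [Nat.div_eq_of_lt (not_le.1 hlt)] at hpd
      omega
    obtain ⟨q, rfl⟩ := Nat.exists_eq_add_of_le' hle
    rw [Nat.add_div_right _ hn] at hpd
    rw [Nat.add_mod_right] at hpm
    exact ⟨q, h q hp, by omega, hpm⟩

theorem IsPeriodClosed.not_dvd {n : ℕ} {P : List ℕ} (h : IsPeriodClosed n P) (h0 : 0 ∉ P) :
    ∀ p ∈ P, ¬ n ∣ p := by
  rintro p hp ⟨k, rfl⟩
  induction k with
  | zero => exact h0 hp
  | succ k ih => exact ih (h _ hp)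

theorem exists_eq_cons_map_succ {P : List ℕ} (hP : P.Pairwise (· < ·)) (h0 : 0 ∈ P) :
    ∃ Q : List ℕ, P = 0 :: Q.map (· + 1) := by
  rcases P with _ | ⟨p, P⟩
  · simp at h0
  rw [List.pairwise_cons] at hP
  have hp : p = 0 := by
    rcases List.mem_cons.1 h0 with h | h
    · exact h.symm
    · exact absurd (hP.1 0 h) (Nat.not_lt_zero _)
  subst hp
  refine ⟨P.map (· - 1), ?_⟩
  rw [List.map_map, List.cons.injEq]
  refine ⟨rfl, ?_⟩
  conv_lhs => rw [← List.map_id P]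
  refine List.map_congr_left fun q hq => ?_
  have := hP.1 q hq
  simp only [id, Function.comp]
  omega

end

section

variable {B W : Type*} [Group W] {M : CoxeterMatrix B} {cs : CoxeterSystem M W}

/-! ### Recursions for sorting words -/

theorem isReducedSubword_cons_iff {s : B} {l : List B} {w : W} {P : List ℕ} {b : List B} :
    IsReducedSubword cs (s :: l) w (0 :: P.map (· + 1)) b ↔
      ∃ a, b = s :: a ∧ cs.IsReduced (s :: a) ∧
        IsReducedSubword cs (l ++ [s]) (cs.simple s * w) P a := by
  constructor
  · rintro ⟨h1, h2, h3, h4⟩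
    cases h2 with
    | @cons _ r _ a hr ha =>
      obtain rfl : s = r := by simpa using hr
      refine ⟨a, rfl, h3, ?_, spells_cons_map_succ.1 ha, IsReduced.right (x := [s]) h3, ?_⟩
      · have := (List.pairwise_cons.1 h1).2
        rw [List.pairwise_map] at this
        exact this.imp fun h => by omega
      · rw [← h4, wordProd_cons, cs.simple_mul_simple_cancel_left]
  · rintro ⟨a, rfl, h3, h1, h2, _, h4⟩
    refine ⟨?_, .cons (by simp) (spells_cons_map_succ.2 h2), h3, ?_⟩
    · rw [List.pairwise_cons, List.pairwise_map]
      exact ⟨fun q hq => by obtain ⟨p, -, rfl⟩ := List.mem_map.1 hq; omega,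
        h1.imp fun h => by omega⟩
    · rw [wordProd_cons, h4, cs.simple_mul_simple_cancel_left]

/-- A nonempty competitor that avoids position 0 is lexicographically larger. The empty one would be
smaller, but it spells only the identity. -/
theorem isSortingWordAt_cons {s : B} {l : List B} {w : W} {P : List ℕ} {a : List B}
    (hsa : cs.IsReduced (s :: a)) (h : IsSortingWordAt cs (l ++ [s]) (cs.simple s * w) P a) :
    IsSortingWordAt cs (s :: l) w (0 :: P.map (· + 1)) (s :: a) := by
  have hmono : StrictMono (fun p : ℕ => p + 1) := fun _ _ h => Nat.succ_lt_succ h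
  have h1 := isReducedSubword_cons_iff.2 ⟨a, rfl, hsa, h.1⟩
  refine ⟨h1, fun Q b hQ => ?_⟩
  by_cases h0 : 0 ∈ Q
  · obtain ⟨R, rfl⟩ := exists_eq_cons_map_succ hQ.1 h0
    obtain ⟨b', rfl, _, hb'⟩ := isReducedSubword_cons_iff.1 hQ
    rw [List.cons.injEq, List.cons_lex_cons_iff]
    simpa using (eq_or_lex_map_iff hmono).2 (h.2 R b' hb')
  · right
    rcases Q with _ | ⟨q, Q⟩
    · obtain ⟨_, h2, _, h4⟩ := hQ
      cases h2
      have h5 := h1.2.2.2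
      rw [← h4] at h5
      unfold CoxeterSystem.IsReduced at hsa
      rw [h5] at hsa
      simp at hsa
    · refine List.Lex.rel ?_
      rw [List.mem_cons, not_or] at h0
      omega

theorem IsSortingWordAt.of_cons {s : B} {l : List B} {w : W} {P : List ℕ} {b : List B}
    (h : IsSortingWordAt cs (s :: l) w (0 :: P.map (· + 1)) b) :
    ∃ a, b = s :: a ∧ IsSortingWordAt cs (l ++ [s]) (cs.simple s * w) P a := by
  have hmono : StrictMono (fun p : ℕ => p + 1) := fun _ _ h => Nat.succ_lt_succ h
  obtain ⟨a, rfl, hsa, ha⟩ := isReducedSubword_cons_iff.1 h.1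
  refine ⟨a, rfl, ha, fun R b hR => ?_⟩
  -- Both `a` and `b` are reduced for the same element, so prefixing `s` is reduced for both or for
  -- neither.
  have hsb : cs.IsReduced (s :: b) := by
    have e1 : b.length = a.length := by rw [← hR.2.2.1.eq, ← ha.2.2.1.eq, hR.2.2.2, ha.2.2.2]
    have e2 : cs.wordProd (s :: b) = cs.wordProd (s :: a) := by
      rw [wordProd_cons, wordProd_cons, hR.2.2.2, ha.2.2.2]
    unfold CoxeterSystem.IsReduced at hsa ⊢
    rw [e2, hsa, List.length_cons, List.length_cons, e1]
  have := h.2 _ _ (isReducedSubword_cons_iff.2 ⟨b, rfl, hsb, hR⟩)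
  rw [List.cons.injEq, List.cons_lex_cons_iff] at this
  exact (eq_or_lex_map_iff hmono).1 (by simpa using this)

theorem IsReducedSubword.skip {s : B} {l : List B} {w : W} {P : List ℕ} {a : List B}
    (h : IsReducedSubword cs l w P a) :
    IsReducedSubword cs (s :: l) w (P.map (skipPosition l.length)) a := by
  refine ⟨?_, h.2.1.skip, h.2.2⟩
  rw [List.pairwise_map]
  exact h.1.imp fun h => skipPosition_strictMono _ h

theorem IsReducedSubword.exists_of_notMem {s : B} {l : List B} {w : W} {Q : List ℕ} {b : List B}
    (h : IsReducedSubword cs (s :: l) w Q b) (hs : s ∉ b) :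
    ∃ P : List ℕ, Q = P.map (skipPosition l.length) ∧ IsReducedSubword cs l w P b := by
  obtain ⟨P, rfl, hP⟩ := h.2.1.exists_of_notMem hs
  refine ⟨P, rfl, ?_, hP, h.2.2⟩
  have := h.1
  rw [List.pairwise_map] at this
  exact this.imp fun h => (skipPosition_strictMono _).lt_iff_lt.1 h

theorem IsSortingWordAt.of_skip {s : B} {l : List B} {w : W} {Q : List ℕ} {b : List B}
    (h : IsSortingWordAt cs (s :: l) w Q b) (hs : s ∉ b) :
    ∃ P : List ℕ, Q = P.map (skipPosition l.length) ∧ IsSortingWordAt cs l w P b := by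
  obtain ⟨P, rfl, hP⟩ := h.1.exists_of_notMem hs
  exact ⟨P, rfl, hP, fun R c hR =>
    (eq_or_lex_map_iff (skipPosition_strictMono _)).1 (h.2 _ c hR.skip)⟩

theorem IsSortingWordAt.eq {l : List B} {w : W} {P Q : List ℕ} {a b : List B}
    (ha : IsSortingWordAt cs l w P a) (hb : IsSortingWordAt cs l w Q b) : P = Q ∧ a = b := by
  have h : P = Q := by
    rcases ha.2 Q b hb.1 with h | h
    · exact h
    · rcases hb.2 P a ha.1 with h' | h'
      · exact h'.symm
      · exact absurd (show P < Q from h) (lt_asymm (show Q < P from h'))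
  subst h
  exact ⟨rfl, ha.1.2.1.eq_of_eq hb.1.2.1⟩

/-- If position 0 is unused, closure excludes all multiples of the period, so the first letter of
`l` never occurs. If it is used, it is taken with empty `x`. -/
theorem IsSortingWordAt.isSortableWord (A : Matrix B B ℝ) {l : List B} {w : W} {P : List ℕ}
    {a : List B} (h : IsSortingWordAt cs l w P a) (hl : l.Nodup)
    (hP : IsPeriodClosed l.length P) : IsSortableWord A l a := by
  induction hn : l.length + a.length generalizing l w P a with
  | zero =>
    obtain ⟨rfl, rfl⟩ : l = [] ∧ a = [] := by
      constructor <;> apply List.eq_nil_of_length_eq_zero <;> omega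
    exact .nil
  | succ n ih =>
    rcases l with _ | ⟨s, l⟩
    · have h2 := h.1.2.1
      cases h2 with
      | nil => exact .nil
      | cons h3 _ => simp at h3
    by_cases h0 : 0 ∈ P
    · obtain ⟨Q, rfl⟩ := exists_eq_cons_map_succ h.1.1 h0
      obtain ⟨b, rfl, hb⟩ := h.of_cons
      refine IsSortableWord.take (x := []) (by simp)
        (ih hb (by rw [List.nodup_append_comm]; exact hl) (fun p hp => ?_) ?_)
      · have h1 := hP (p + 1) (by
          simp only [List.length_append, List.length_cons, List.length_nil] at hp ⊢
          refine List.mem_cons_of_mem _ (List.mem_map.2 ⟨_, hp, by omega⟩))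
        simpa using h1
      · simp at hn ⊢; omega
    · have hs := h.1.2.1.notMem (List.nodup_cons.1 hl).1 (hP.not_dvd h0)
      obtain ⟨Q, rfl, hQ⟩ := h.of_skip hs
      refine .skip hs (ih hQ (List.nodup_cons.1 hl).2 (fun p hp => ?_) ?_)
      · rcases Nat.eq_zero_or_pos l.length with h1 | h1
        · simpa [h1] using hp
        · have h2 := hP (skipPosition l.length p) (by
            rw [List.length_cons, ← skipPosition_add h1]
            exact List.mem_map_of_mem hp)
          obtain ⟨q, hq, he⟩ := List.mem_map.1 h2
          rwa [← (skipPosition_strictMono _).injective he]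
      · simp at hn ⊢; omega

/-! ### Commutation classes of words -/

theorem CommutationMove.symm {a b : List B} (h : CommutationMove cs a b) :
    CommutationMove cs b a := by
  obtain ⟨x, y, s, s', hc, rfl, rfl⟩ := h
  exact ⟨x, y, s', s, hc.symm, rfl, rfl⟩

theorem CommutationMove.cons {a b : List B} (h : CommutationMove cs a b) (r : B) :
    CommutationMove cs (r :: a) (r :: b) := by
  obtain ⟨x, y, s, s', hc, rfl, rfl⟩ := h
  exact ⟨r :: x, y, s, s', hc, rfl, rfl⟩

theorem CommutationMove.perm {a b : List B} (h : CommutationMove cs a b) : a.Perm b := by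
  obtain ⟨x, y, s, s', hc, rfl, rfl⟩ := h
  exact (List.Perm.swap s' s y).append_left x

theorem CommutationMove.wordProd_eq {a b : List B} (h : CommutationMove cs a b) :
    cs.wordProd a = cs.wordProd b := by
  obtain ⟨x, y, s, s', hc, rfl, rfl⟩ := h
  rw [wordProd_append, wordProd_append]
  simp only [wordProd_cons]
  rw [← mul_assoc (cs.simple s), hc.eq, mul_assoc]

theorem commutation_symm {a b : List B} (h : Relation.ReflTransGen (CommutationMove cs) a b) :
    Relation.ReflTransGen (CommutationMove cs) b a :=
  haveI : Std.Symm (CommutationMove cs) := ⟨fun _ _ => CommutationMove.symm⟩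
  Relation.ReflTransGen.stdSymm.symm _ _ h

theorem commutation_cons {a b : List B} (h : Relation.ReflTransGen (CommutationMove cs) a b)
    (r : B) : Relation.ReflTransGen (CommutationMove cs) (r :: a) (r :: b) :=
  h.lift _ fun _ _ h => h.cons r

theorem commutation_perm {a b : List B} (h : Relation.ReflTransGen (CommutationMove cs) a b) :
    a.Perm b := by
  induction h with
  | refl => exact .refl _
  | tail _ h ih => exact ih.trans h.perm

theorem commutation_wordProd_eq {a b : List B}
    (h : Relation.ReflTransGen (CommutationMove cs) a b) : cs.wordProd a = cs.wordProd b := by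
  induction h with
  | refl => rfl
  | tail _ h ih => exact ih.trans h.wordProd_eq

theorem commutation_isReduced {a b : List B}
    (h : Relation.ReflTransGen (CommutationMove cs) a b) (ha : cs.IsReduced a) :
    cs.IsReduced b := by
  unfold CoxeterSystem.IsReduced at *
  rw [← commutation_wordProd_eq h, ha, (commutation_perm h).length_eq]

theorem commutation_append_cons {x : List B} {s : B}
    (hx : ∀ q ∈ x, Commute (cs.simple q) (cs.simple s)) (y : List B) :
    Relation.ReflTransGen (CommutationMove cs) (x ++ s :: y) (s :: (x ++ y)) := by
  induction x with
  | nil => exact .refl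
  | cons q x ih =>
    rw [List.forall_mem_cons] at hx
    exact (commutation_cons (ih hx.2) q).tail ⟨[], x ++ y, q, s, hx.1, rfl, rfl⟩

end

/-! ### Sortable words up to commutation and sorting words. -/

variable {B W : Type*} [Fintype B] [DecidableEq B] [Group W] {M : CoxeterMatrix B}
  {cs : CoxeterSystem M W} {A : Matrix B B ℝ} {δ : B → ℝ}

theorem IsSortableWord.commutation (hA : IsCartanMatrix M A) (hδ : IsSymmetrizer cs A δ)
    {l a b : List B} (h : IsSortableWord A l a)
    (hab : Relation.ReflTransGen (CommutationMove cs) a b) : IsSortableWord A l b := by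
  induction hab with
  | refl => exact h
  | tail _ hm ih =>
    obtain ⟨x, y, s, s', hc, rfl, rfl⟩ := hm
    by_cases hs : s = s'
    · subst hs; exact ih
    · exact ih.swap hA rfl (eq_zero_of_commute_simple hA hδ hs hc)

theorem IsSortableWord.exists_isSortingWordAt (hA : IsCartanMatrix M A) (hδ : IsSymmetrizer cs A δ)
    {l a : List B} (h : IsSortableWord A l a) (hl : l.Nodup) (ha : cs.IsReduced a) :
    ∃ P a', IsSortingWordAt cs l (cs.wordProd a) P a' ∧ IsPeriodClosed l.length P ∧
      Relation.ReflTransGen (CommutationMove cs) a a' := by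
  induction h with
  | nil =>
    refine ⟨[], [], ⟨⟨.nil, .nil, ha, rfl⟩, fun Q b hb => ?_⟩, by simp [IsPeriodClosed], .refl⟩
    have h1 := hb.2.1
    cases h1 with
    | nil => exact Or.inl rfl
    | cons h _ => simp at h
  | @skip s l a hs _ ih =>
    obtain ⟨P, a', h1, h2, h3⟩ := ih (List.nodup_cons.1 hl).2 ha
    refine ⟨P.map (skipPosition l.length), a', ⟨h1.1.skip, fun Q b hb => ?_⟩, fun p hp => ?_, h3⟩
    -- All reduced words for the element avoid `s`, so every competitor comes from a subword of
    -- `l^∞`.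
    · obtain ⟨R, rfl, hR⟩ := hb.exists_of_notMem
        (notMem_of_wordProd_eq hA hδ hb.2.2.1 hb.2.2.2 hs)
      exact (eq_or_lex_map_iff (skipPosition_strictMono _)).2 (h1.2 R b hR)
    · obtain ⟨q, hq, he⟩ := List.mem_map.1 hp
      rcases Nat.eq_zero_or_pos l.length with h4 | h4
      · obtain rfl := List.length_eq_zero_iff.1 h4
        have h5 := h1.1.2.1
        cases h5 with
        | nil => simp at hq
        | cons h _ => simp at h
      · have h5 := skipPosition_mod h4 q
        have h6 : l.length ≤ q := by
          by_contra h7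
          rw [skipPosition, Nat.div_eq_of_lt (by omega), Nat.mod_eq_of_lt (by omega),
            List.length_cons] at he
          omega
        obtain ⟨r, rfl⟩ := Nat.exists_eq_add_of_le' h6
        rw [skipPosition_add h4, List.length_cons, Nat.add_right_cancel_iff] at he
        rw [← he]
        exact List.mem_map_of_mem (h2 r hq)
  | @take s l x y hx _ ih =>
    have hred := (isReduced_cons_append hA hδ hx).2 ha
    obtain ⟨P, a', h1, h2, h3⟩ := ih (by rw [List.nodup_append_comm]; exact hl)
      (IsReduced.right (x := [s]) hred)
    have h4 := commutation_cons h3 s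
    refine ⟨0 :: P.map (· + 1), s :: a', isSortingWordAt_cons (commutation_isReduced h4 hred) ?_,
      fun p hp => ?_, (commutation_append_cons
        (fun q hq => commute_simple_of_eq_zero hA hδ (hx q hq)) y).trans h4⟩
    · rwa [wordProd_append_cons_of_eq_zero hA hδ hx, wordProd_cons,
        cs.simple_mul_simple_cancel_left]
    · rcases p with _ | p
      · exact .head _
      · have h5 : p + (l.length + 1) ∈ P := by
          simp only [List.mem_cons, List.mem_map, List.length_cons] at hp
          rcases hp with hp | ⟨q, hq, he⟩
          · omega
          · rwa [show p + (l.length + 1) = q by omega]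
        exact List.mem_cons_of_mem _ (List.mem_map_of_mem (f := (· + 1)) (h2 p (by simpa using h5)))

end Cambrian

namespace Cambrian

open CoxeterSystem

section

variable {B W : Type*} [Fintype B] [DecidableEq B] [Group W] {M : CoxeterMatrix B}
  {cs : CoxeterSystem M W} {A : Matrix B B ℝ} {δ : B → ℝ}

/-! ### Reduced words of Coxeter elements -/

theorem isReduced_of_nodup (hA : IsCartanMatrix M A) (hδ : IsSymmetrizer cs A δ) {l : List B}
    (hl : l.Nodup) : cs.IsReduced l := by
  induction l using List.reverseRecOn with
  | nil => simp [CoxeterSystem.IsReduced]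
  | append_singleton l s ih =>
    rw [List.nodup_append_comm, List.singleton_append, List.nodup_cons] at hl
    have h1 := not_isRightDescent_of_apply_pos hA hδ (w := cs.wordProd l) (s := s) (r := s) (by
      rw [reflRep_wordProd_apply_of_notMem cs hA hl.1, simpleRoot_apply_self]; exact one_pos)
    rw [cs.not_isRightDescent_iff, (ih hl.2).eq] at h1
    rw [CoxeterSystem.IsReduced, ← List.concat_eq_append, wordProd_concat, h1, List.length_concat]

/-- By exchange, deleting some `r` from l' = x r y leaves a reduced word for the tail of `l`.
Inductively `s` is not in `x`; comparing `s`-coordinates in xα_r = α_s gives r = s, and the zero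
displacement shows that `x` commutes with `s`. -/
theorem commutation_of_wordProd_eq_nodup (hA : IsCartanMatrix M A) (hδ : IsSymmetrizer cs A δ)
    {l l' : List B} (hl : l.Nodup) (hl' : cs.IsReduced l')
    (h : cs.wordProd l' = cs.wordProd l) : Relation.ReflTransGen (CommutationMove cs) l' l := by
  induction l generalizing l' with
  | nil =>
    unfold CoxeterSystem.IsReduced at hl'
    rw [h, wordProd_nil, length_one] at hl'
    rw [List.eq_nil_of_length_eq_zero hl'.symm]
  | cons s l ih =>
    have hred := isReduced_of_nodup hA hδ hl
    have hd := IsReduced.isLeftDescent hred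
    rw [← h] at hd
    obtain ⟨x, r, y, rfl, hr⟩ := exists_root_eq_simpleRoot hA hδ hd
    have hconj : cs.wordProd x * cs.simple r * (cs.wordProd x)⁻¹ = cs.simple s := by
      simpa using (conj_simple_eq_of_root_eq_smul hA hδ (w := 1) (s := s) (μ := 1)
        (by simpa using hr)).1
    have hprod : cs.wordProd (x ++ y) = cs.wordProd l := by
      have h1 : cs.simple s * cs.wordProd (x ++ y) = cs.simple s * cs.wordProd l := by
        rw [← wordProd_cons _ s l, ← h, ← hconj, wordProd_append, wordProd_append, wordProd_cons]
        group
      exact mul_left_cancel h1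
    have hlen : (x ++ r :: y).length = (s :: l).length := by rw [← hl'.eq, h, hred.eq]
    have hxy : cs.IsReduced (x ++ y) := by
      unfold CoxeterSystem.IsReduced
      rw [hprod, (isReduced_of_nodup hA hδ (List.nodup_cons.1 hl).2).eq]
      simp at hlen ⊢; omega
    have hxy' := ih (List.nodup_cons.1 hl).2 hxy hprod
    have hsx : s ∉ x := fun hs => (List.nodup_cons.1 hl).1
      ((commutation_perm hxy').mem_iff.1 (List.mem_append_left _ hs))
    obtain rfl : s = r := by
      by_contra hne
      have h2 := congrFun hr s
      rw [reflRep_wordProd_apply_of_notMem cs hA hsx, simpleRoot_apply_self,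
        simpleRoot_apply_of_ne hne] at h2
      exact zero_ne_one h2
    have hx := (cartanForm_displacement hA hδ (IsReduced.left hl') hsx).2
      (by rw [hr, sub_self, map_zero])
    exact (commutation_append_cons (fun q hq => commute_simple_of_eq_zero hA hδ (hx q hq)) y).trans
      (commutation_cons hxy' s)

/-- Only the relative order of the swapped pair changes, and its entries are zero in either order.
-/
theorem CommutationMove.eulerForm_eq (hA : IsCartanMatrix M A) (hδ : IsSymmetrizer cs A δ)
    {l l' : List B} (h : CommutationMove cs l l') (hl : l.Nodup) :
    eulerForm A δ l = eulerForm A δ l' := by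
  obtain ⟨x, y, s, s', hc, rfl, rfl⟩ := h
  have hne : s ≠ s' := by
    rintro rfl
    simp [List.nodup_append] at hl
  have h1 := eq_zero_of_commute_simple hA hδ hne hc
  have h2 := (hA.zero_iff _ _).1 h1
  unfold eulerForm
  congr 2
  ext r q
  have hr : r ∈ x → x.idxOf r < x.length := List.idxOf_lt_length_iff.2
  have hq : q ∈ x → x.idxOf q < x.length := List.idxOf_lt_length_iff.2
  by_cases e : (r = s ∧ q = s') ∨ (r = s' ∧ q = s)
  · rcases e with ⟨rfl, rfl⟩ | ⟨rfl, rfl⟩ <;> simp [h1, h2, hne, hne.symm]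
  · have : (x ++ s :: s' :: y).idxOf q < (x ++ s :: s' :: y).idxOf r ↔
        (x ++ s' :: s :: y).idxOf q < (x ++ s' :: s :: y).idxOf r := by
      simp only [List.idxOf_append, List.idxOf_cons]
      grind
    simp only [this]

theorem commutation_omegaForm_eq (hA : IsCartanMatrix M A) (hδ : IsSymmetrizer cs A δ)
    {l l' : List B} (h : Relation.ReflTransGen (CommutationMove cs) l l') (hl : l.Nodup) :
    omegaForm A δ l = omegaForm A δ l' := by
  have : eulerForm A δ l = eulerForm A δ l' := by
    induction h with
    | refl => rfl
    | tail h1 h2 ih => exact ih.trans (h2.eulerForm_eq hA hδ ((commutation_perm h1).nodup hl))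
  funext β β'
  rw [omegaForm, omegaForm, this]

/-! ### Positive roots of reflections -/

theorem posRoot_eq (hA : IsCartanMatrix M A) (hδ : IsSymmetrizer cs A δ) {u : W} {s : B}
    (h : 0 ≤ reflRep cs hA u (simpleRoot s)) :
    posRoot cs hA (u * cs.simple s * u⁻¹) = reflRep cs hA u (simpleRoot s) := by
  obtain ⟨⟨u', s', ht, hβ⟩, h0⟩ : IsPositiveRootOf cs hA (u * cs.simple s * u⁻¹)
      (posRoot cs hA (u * cs.simple s * u⁻¹)) :=
    Classical.epsilon_spec (p := fun β => IsPositiveRootOf cs hA (u * cs.simple s * u⁻¹) β)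
      ⟨_, ⟨u, s, rfl, rfl⟩, h⟩
  rw [hβ] at h0 ⊢
  exact root_eq_of_conj_eq hA hδ ht.symm h h0

theorem length_rootSeq (hA : IsCartanMatrix M A) (a : List B) :
    (rootSeq hA cs a).length = a.length := by
  induction a with
  | nil => rfl
  | cons s a ih => simp [rootSeq, ih]

theorem getElem_rootSeq (hA : IsCartanMatrix M A) (a : List B) (i : ℕ) (hi : i < a.length) :
    (rootSeq hA cs a)[i]'(by rwa [length_rootSeq]) =
      reflRep cs hA (cs.wordProd (a.take i)) (simpleRoot a[i]) := by
  induction a generalizing i with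
  | nil => simp at hi
  | cons s a ih =>
    cases i with
    | zero => simp [rootSeq]
    | succ i =>
      simp only [rootSeq, List.getElem_cons_succ, List.getElem_map, List.take_succ_cons,
        wordProd_cons, reflRep_mul_apply]
      rw [ih]

theorem isAligned_iff (hA : IsCartanMatrix M A) (hδ : IsSymmetrizer cs A δ) {l a : List B}
    (ha : cs.IsReduced a) : IsAligned hA δ cs l a ↔
      ∀ i j : Fin (cs.leftInvSeq a).length, i ≤ j →
        0 ≤ omegaForm A δ l (posRoot cs hA ((cs.leftInvSeq a).get i))
          (posRoot cs hA ((cs.leftInvSeq a).get j)) ∧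
        (¬ Commute ((cs.leftInvSeq a).get i) ((cs.leftInvSeq a).get j) →
          0 < omegaForm A δ l (posRoot cs hA ((cs.leftInvSeq a).get i))
            (posRoot cs hA ((cs.leftInvSeq a).get j))) := by
  have hnn (i : ℕ) (hi : i < a.length) :
      0 ≤ reflRep cs hA (cs.wordProd (a.take i)) (simpleRoot a[i]) := by
    rw [← getElem_rootSeq hA a i hi]
    exact rootSeq_nonneg hA hδ ha (List.getElem_mem _)
  have hroot (i : Fin (cs.leftInvSeq a).length) : posRoot cs hA ((cs.leftInvSeq a).get i) =
      (rootSeq hA cs a)[i.1]'(by rw [length_rootSeq, ← cs.length_leftInvSeq]; exact i.2) := by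
    have hi : i.1 < a.length := by rw [← cs.length_leftInvSeq]; exact i.2
    rw [List.get_eq_getElem, getElem_leftInvSeq cs a i.1 hi, posRoot_eq hA hδ (hnn _ hi),
      getElem_rootSeq hA a i.1 hi]
  have hcomm (i j : Fin (cs.leftInvSeq a).length) (hij : i ≠ j) :
      Commute ((cs.leftInvSeq a).get i) ((cs.leftInvSeq a).get j) ↔
        cartanForm A δ (posRoot cs hA ((cs.leftInvSeq a).get i))
          (posRoot cs hA ((cs.leftInvSeq a).get j)) = 0 := by
    -- Commuting means orthogonal only for distinct reflections; reducedness makes those of `a`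
    -- distinct.
    have hne : (cs.leftInvSeq a).get i ≠ (cs.leftInvSeq a).get j :=
      (List.nodup_iff_injective_get.1 ha.nodup_leftInvSeq).ne hij
    have hi : i.1 < a.length := by rw [← cs.length_leftInvSeq]; exact i.2
    have hj : j.1 < a.length := by rw [← cs.length_leftInvSeq]; exact j.2
    rw [List.get_eq_getElem, List.get_eq_getElem, getElem_leftInvSeq cs a i.1 hi,
      getElem_leftInvSeq cs a j.1 hj] at hne ⊢
    rw [posRoot_eq hA hδ (hnn _ hi), posRoot_eq hA hδ (hnn _ hj)]
    exact ⟨fun h => cartanForm_eq_zero_of_commute hA hδ h hne,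
      commute_conj_simple_of_cartanForm_eq_zero hA hδ⟩
  rw [IsAligned, List.pairwise_iff_getElem]
  constructor
  · intro h i j hij
    rcases hij.eq_or_lt with rfl | hlt
    · exact ⟨by simp [omegaForm], fun h => absurd (Commute.refl _) h⟩
    · rw [hcomm i j hlt.ne, hroot, hroot]
      exact h i.1 j.1 _ _ hlt
  · intro h i j hi hj hij
    rw [length_rootSeq, ← cs.length_leftInvSeq] at hi hj
    have h1 := h ⟨i, hi⟩ ⟨j, hj⟩ hij.le
    rwa [hcomm _ _ (by simpa using hij.ne), hroot, hroot] at h1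

end

end Cambrian

/-! ### The equivalence. -/

theorem mainTheorem5 {B W : Type*} [Fintype B] [DecidableEq B] [Group W] {M : CoxeterMatrix B}
    (cs : CoxeterSystem M W)
    (A : Matrix B B ℝ) (hA : Cambrian.IsCartanMatrix M A)
    (δ : B → ℝ) (hδ : Cambrian.IsSymmetrizer cs A δ)
    (l : List B) (hl : Cambrian.IsCoxeterWord l) (c : W) (hc : cs.wordProd l = c)
    (w : W) (a : List B) (ha : cs.IsReduced a) (hw : cs.wordProd a = w) :
    (∀ i j : Fin (cs.leftInvSeq a).length, i ≤ j →
      0 ≤ Cambrian.omegaForm A δ l (Cambrian.posRoot cs hA ((cs.leftInvSeq a).get i))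
            (Cambrian.posRoot cs hA ((cs.leftInvSeq a).get j)) ∧
      (¬ Commute ((cs.leftInvSeq a).get i) ((cs.leftInvSeq a).get j) →
        0 < Cambrian.omegaForm A δ l (Cambrian.posRoot cs hA ((cs.leftInvSeq a).get i))
            (Cambrian.posRoot cs hA ((cs.leftInvSeq a).get j)))) ↔
    (Cambrian.IsSortable cs c w ∧
      ∃ a' : List B, Cambrian.IsSortingWord cs c w a' ∧
        Relation.ReflTransGen (Cambrian.CommutationMove cs) a a') := by
  subst hc hw
  rw [← Cambrian.isAligned_iff hA hδ ha]
  constructor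
  · intro h
    obtain ⟨P, a', h1, h2, h3⟩ := (h.isSortableWord hA hδ hl.1 ha
      fun q _ => hl.2 q).exists_isSortingWordAt hA hδ hl.1 ha
    have hred := Cambrian.isReduced_of_nodup hA hδ hl.1
    exact ⟨⟨l, hred, rfl, P, a', h1, (Cambrian.antitone_block_iff hl.1).2 h2⟩,
      a', ⟨l, hred, rfl, P, h1⟩, h3⟩
  · rintro ⟨⟨l₁, hl₁, hc₁, P₁, a₁, h₁, hP₁⟩, a₂, ⟨l₂, hl₂, hc₂, P₂, h₂⟩, ha₂⟩
    have hm₁ := Cambrian.commutation_symm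
      (Cambrian.commutation_of_wordProd_eq_nodup hA hδ hl.1 hl₁ hc₁)
    have hm₂ := Cambrian.commutation_symm
      (Cambrian.commutation_of_wordProd_eq_nodup hA hδ hl.1 hl₂ hc₂)
    have hn₁ := (Cambrian.commutation_perm hm₁).nodup hl.1
    have hn₂ := (Cambrian.commutation_perm hm₂).nodup hl.1
    -- Sortability and the sorting word may use different words `l₁`, `l₂` for c. Alignment depends
    -- only on ω, so it transfers sortability from `l₁` to `l₂`.
    have hal : Cambrian.IsAligned hA δ cs l₁ a₁ :=
      (h₁.isSortableWord A hn₁ ((Cambrian.antitone_block_iff hn₁).1 hP₁)).isAligned hA hδ hn₁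
        h₁.1.2.2.1
    rw [Cambrian.IsAligned, ← Cambrian.commutation_omegaForm_eq hA hδ hm₁ hl.1,
      Cambrian.commutation_omegaForm_eq hA hδ hm₂ hl.1] at hal
    have hs₂ : Cambrian.IsSortableWord A l₂ a₁ := Cambrian.IsAligned.isSortableWord hA hδ hal hn₂
      h₁.1.2.2.1 fun q _ => (Cambrian.commutation_perm hm₂).mem_iff.1 (hl.2 q)
    obtain ⟨P, a', h', -, ha'⟩ := hs₂.exists_isSortingWordAt hA hδ hn₂ h₁.1.2.2.1
    rw [h₁.1.2.2.2] at h'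
    -- Uniqueness of the `l₂`-sorting word links `a₁` to `a` by commutations.
    obtain ⟨-, rfl⟩ := h'.eq h₂
    have hs := (hs₂.commutation hA hδ ha').commutation hA hδ (Cambrian.commutation_symm ha₂)
    have := hs.isAligned hA hδ hn₂ ha
    rwa [Cambrian.IsAligned, ← Cambrian.commutation_omegaForm_eq hA hδ hm₂ hl.1] at this
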